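/- Let $\Bbbk$ be an infinite field (in particular, $\Bbbk$ may be any algebraically closed field), let $m,n,d_1,d_2$ be nonnegative integers, and let $\Lambda=\Lambda(m,n)$ be the algebra of the quiver with two vertices $1,2$, a loop $a$ at $1$, a loop $b$ at $2$ and an arrow $c\colon 1\to 2$, with relations $a^m=b^n=ca-bc=b^2c=0$. Let $\operatorname{rep}_\Lambda(d_1,d_2)$ be the variety of triples $(A,B,C)\in \mathrm{Mat}_{d_1\times d_1}(\Bbbk)\times \mathrm{Mat}_{d_2\times d_2}(\Bbbk)\times \mathrm{Mat}_{d_2\times d_1}(\Bbbk)$ with $A^m=0$, $B^n=0$, $CA=BC$, $B^2C=0$, with its Zariski topology (on $\Bbbk$-points) and the action $(g,h)\cdot(A,B,C)=(gAg^{-1},hBh^{-1},hCg^{-1})$ of $GL(d_1)\times GL(d_2)$. Write $J_r=\Bbbk[T]/(T^r)$. For partitions $\mathbf p=(p_1\ge\dots\ge p_s)$ of $d_1$ with parts at most $m$ and $\mathbf q=(q_1\ge\dots\ge q_l)$ of $d_2$ with parts at most $n$, let $\operatorname{rep}^{\mathbf p,\mathbf q}_\Lambda(d_1,d_2)$ be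 the set of those $(A,B,C)\in\operatorname{rep}_\Lambda(d_1,d_2)$ for which the $\Bbbk[T]$-modules $(\Bbbk^{d_1},A)$ and $(\Bbbk^{d_2},B)$ (with $T$ acting by $A$, resp. $B$) are isomorphic to $\bigoplus_j J_{p_j}$ and $\bigoplus_i J_{q_i}$. Say that $(A,B,C)$ is equivalent to a matrix $N$ over $\Bbbk[T]$, with columns labeled by $J_{p_1},\dots,J_{p_s}$ and rows labeled by $J_{q_1},\dots,J_{q_l}$, if there are $\Bbbk[T]$-module isomorphisms $\varphi\colon(\Bbbk^{d_1},A)\to\bigoplus_j J_{p_j}$ and $\psi\colon(\Bbbk^{d_2},B)\to\bigoplus_i J_{q_i}$ such that $\psi C\varphi^{-1}$ is the map given by $N$. Suppose that $\mathbf p=(p_1,\dots,p_k,1)$ with $p_1\ge\dots\ge p_k\ge 3$ ($k\ge 0$) and $\mathbf q=(q_1,\dots,q_l)$ with $q_1\ge\dots\ge q_l\ge 2$ ($l\ge 0$). Let $M_{\mathbf p,\mathbf q}$ be the $l\times(k+1)$ staircase matrix $$ M_{\mathbf p,\mathbf q}=\begin{pmatrix} \ddots & \ddots & \ddots & \ddots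 & \vdots\\ \ddots & T^{q_{l-2}-2} & T^{q_{l-2}-2} & 0 & 0\\ \ddots & 0 & T^{q_{l-1}-2} & T^{q_{l-1}-2} & 0\\ \cdots & 0 & 0 & T^{q_l-2} & T^{q_l-1} \end{pmatrix}, $$ that is, numbering rows and columns from $0$ starting at the bottom right corner, the entry in row $i$ and column $j$ is zero unless $j\in\{i,i+1\}$; the entry at $i=j=0$ is $T^{q_l-1}$, and the other entries with $j\in\{i,i+1\}$ are $T^{q-2}$, where $J_q$ is the label of the row. Then a general element of $\operatorname{rep}^{\mathbf p,\mathbf q}_\Lambda(d_1,d_2)$ is equivalent to $M_{\mathbf p,\mathbf q}$: there is a dense open subset $U$ of $\operatorname{rep}^{\mathbf p,\mathbf q}_\Lambda(d_1,d_2)$ all of whose elements are equivalent to $M_{\mathbf p,\mathbf q}$. Moreover, $\operatorname{rep}^{\mathbf p,\mathbf q}_\Lambda(d_1,d_2)$ has a dense $GL(d_1)\times GL(d_2)$-orbit, namely that of a point of the stratum equivalent to $M_{\mathbf p,\mathbf q}$. -/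

import Mathlib

open scoped Polynomial

/-- `p = (p_1 ≥ p_2 ≥ … ≥ p_r)` is a partition of `d` with `r` (positive) parts, all of size at
most `e`. -/
def IsPartitionOf {r : ℕ} (e d : ℕ) (p : Fin r → ℕ) : Prop :=
  Antitone p ∧ (∀ i, 1 ≤ p i ∧ p i ≤ e) ∧ ∑ i, p i = d

/-- A triple of matrices `(A, B, C)`: a representation, with dimension vector `(d₁, d₂)`, of the
quiver with a loop `a` at vertex `1`, a loop `b` at vertex `2` and an arrow `c : 1 → 2`. -/
@[ext]
structure QuiverRep (K : Type*) (d₁ d₂ : ℕ) where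
  A : Matrix (Fin d₁) (Fin d₁) K
  B : Matrix (Fin d₂) (Fin d₂) K
  C : Matrix (Fin d₂) (Fin d₁) K

namespace QuiverRep

variable {K : Type*} [Field K] {d₁ d₂ : ℕ}

/-- The index set of the coordinates (matrix entries) of the affine space of all triples. -/
abbrev Coord (d₁ d₂ : ℕ) : Type :=
  (Fin d₁ × Fin d₁) ⊕ (Fin d₂ × Fin d₂) ⊕ (Fin d₂ × Fin d₁)

/-- The coordinates of a triple. -/
def coord (x : QuiverRep K d₁ d₂) : Coord d₁ d₂ → K
  | .inl ij => x.A ij.1 ij.2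
  | .inr (.inl ij) => x.B ij.1 ij.2
  | .inr (.inr ij) => x.C ij.1 ij.2

/-- The Zariski topology on the affine space of triples: the principal open sets
`{x | f x ≠ 0}`, for `f` a polynomial in the matrix entries, generate it. -/
instance zariski : TopologicalSpace (QuiverRep K d₁ d₂) :=
  TopologicalSpace.generateFrom
    {U | ∃ f : MvPolynomial (Coord d₁ d₂) K, U = {x | MvPolynomial.eval x.coord f ≠ 0}}

/-- The base change action of `GL(d₁) × GL(d₂)`:
`(g, h) • (A, B, C) = (g A g⁻¹, h B h⁻¹, h C g⁻¹)`. -/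
instance baseChange :
    MulAction (GL (Fin d₁) K × GL (Fin d₂) K) (QuiverRep K d₁ d₂) where
  smul g x :=
    { A := g.1.val * x.A * (g.1⁻¹).val
      B := g.2.val * x.B * (g.2⁻¹).val
      C := g.2.val * x.C * (g.1⁻¹).val }
  one_smul x := by
    apply QuiverRep.ext
    · change (1 : GL (Fin d₁) K).val * x.A * ((1 : GL (Fin d₁) K)⁻¹).val = x.A
      simp
    · change (1 : GL (Fin d₂) K).val * x.B * ((1 : GL (Fin d₂) K)⁻¹).val = x.B
      simp
    · change (1 : GL (Fin d₂) K).val * x.C * ((1 : GL (Fin d₁) K)⁻¹).val = x.C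
      simp
  mul_smul g h x := by
    apply QuiverRep.ext
    · change (g.1 * h.1).val * x.A * ((g.1 * h.1)⁻¹).val =
        g.1.val * (h.1.val * x.A * (h.1⁻¹).val) * (g.1⁻¹).val
      rw [mul_inv_rev, Units.val_mul, Units.val_mul]
      simp only [Matrix.mul_assoc]
    · change (g.2 * h.2).val * x.B * ((g.2 * h.2)⁻¹).val =
        g.2.val * (h.2.val * x.B * (h.2⁻¹).val) * (g.2⁻¹).val
      rw [mul_inv_rev, Units.val_mul, Units.val_mul]
      simp only [Matrix.mul_assoc]
    · change (g.2 * h.2).val * x.C * ((g.1 * h.1)⁻¹).val =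
        g.2.val * (h.2.val * x.C * (h.1⁻¹).val) * (g.1⁻¹).val
      rw [mul_inv_rev, Units.val_mul, Units.val_mul]
      simp only [Matrix.mul_assoc]

end QuiverRep

section Strata

variable (K : Type*) [Field K]

/-- The representation variety of `Λ(m, n)`, cut out by the relations
`a ^ m = b ^ n = c a - b c = b ^ 2 c = 0`. -/
def repVariety (m n d₁ d₂ : ℕ) : Set (QuiverRep K d₁ d₂) :=
  {x | x.A ^ m = 0 ∧ x.B ^ n = 0 ∧ x.C * x.A - x.B * x.C = 0 ∧ x.B ^ 2 * x.C = 0}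

/-- The cyclic `K[T]`-module `J_r = K[T] / (T ^ r)`. -/
abbrev JModule (r : ℕ) : Type _ := K[X] ⧸ Ideal.span {(Polynomial.X : K[X]) ^ r}

variable {K}

/-- The `K[T]`-module `K ^ d` on which `T` acts by the matrix `A`. -/
abbrev matrixModule {d : ℕ} (A : Matrix (Fin d) (Fin d) K) : Type _ :=
  Module.AEval' (Matrix.toLin' A)

/-- The matrix `A` is nilpotent of type `p`: the associated `K[T]`-module is isomorphic to
`⨁ i, K[T] / (T ^ p_i)`. -/
def HasType {d r : ℕ} (A : Matrix (Fin d) (Fin d) K) (p : Fin r → ℕ) : Prop :=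
  Nonempty (matrixModule A ≃ₗ[K[X]] ((i : Fin r) → JModule K (p i)))

variable (K)

/-- The stratum of the representation variety of `Λ(m, n)` in which `A` has type `p` and `B` has
type `q`. -/
def stratum (m n d₁ d₂ : ℕ) {s r : ℕ} (p : Fin s → ℕ) (q : Fin r → ℕ) :
    Set (QuiverRep K d₁ d₂) :=
  {x | x ∈ repVariety K m n d₁ d₂ ∧ HasType x.A p ∧ HasType x.B q}

variable {K}

/-- The representation `x = (A, B, C)` is equivalent to the `K[T]`-labeled matrix `N`, with columns
labeled by `J_{p_1}, …, J_{p_s}` and rows labeled by `J_{q_1}, …, J_{q_r}`: there are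
`K[T]`-module isomorphisms `φ` from `(K ^ d₁, A)` to `⨁ j, J_{p_j}` and `ψ` from `(K ^ d₂, B)` to
`⨁ i, J_{q_i}` such that `ψ ∘ C ∘ φ⁻¹` is the map given by the matrix `N`, that is, it sends the
class of a column vector `f` of polynomials to the class of `N f`. -/
def IsEquivalentTo {d₁ d₂ s r : ℕ} (x : QuiverRep K d₁ d₂) (p : Fin s → ℕ) (q : Fin r → ℕ)
    (N : Matrix (Fin r) (Fin s) K[X]) : Prop :=
  ∃ (φ : matrixModule x.A ≃ₗ[K[X]] ((j : Fin s) → JModule K (p j)))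
    (ψ : matrixModule x.B ≃ₗ[K[X]] ((i : Fin r) → JModule K (q i))),
    ∀ f : Fin s → K[X],
      ψ (Module.AEval'.of (Matrix.toLin' x.B)
          (x.C.mulVec ((Module.AEval'.of (Matrix.toLin' x.A)).symm
            (φ.symm fun j => Ideal.Quotient.mk _ (f j))))) =
        fun i => Ideal.Quotient.mk _ (N.mulVec f i)

variable (K)

/-- The entry `T^*` in a row labeled `J_i` and a column labeled `J_j`: it is `T ^ (i - 1)` if
`j = 1`, and `T ^ (i - 2)` if `i, j > 1`. -/
noncomputable def tStar (i j : ℕ) : K[X] :=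
  if j = 1 then Polynomial.X ^ (i - 1) else Polynomial.X ^ (i - 2)

/-- The staircase matrix `M_{p,q}`. Rows and columns are counted from the bottom right corner
(`Fin.rev`); the nonzero entries are those on the diagonal through that corner and those
immediately to the left of this diagonal, and each of them is `T^*`. -/
noncomputable def staircase {s r : ℕ} (p : Fin s → ℕ) (q : Fin r → ℕ) :
    Matrix (Fin r) (Fin s) K[X] :=
  Matrix.of fun i j =>
    if (j.rev : ℕ) = i.rev ∨ (j.rev : ℕ) = i.rev + 1 then tStar K (q i) (p j) else 0

end Strata

/-! For fixed `A`, `B` of types `p`, `q`, the admissible `C` form the vector space `V` of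
homomorphisms `⨁ J_{p_j} → ⨁ J_{q_i}` killed by `T ^ 2`, on which the automorphisms of both sides
act. As `A` and `B` are unique up to conjugation, it suffices that the orbit of the staircase matrix
`M` is open and dense.

Infinitesimally, every `Z` in `V` has the form `H M - M G` (`mem_tangentMatrices_staircase`). Over
`K[T]`, `V` is spanned by matrices with a single entry `T^*`. A row or column operation on `M`
yields a sum of two adjacent ones; the last column, with at most one nonzero entry, yields the
corner alone. Climbing the staircase from this corner and then moving outwards isolates every
position.

Openness follows in any characteristic, without differentiating the orbit map. `Hom(y, x)` is the
kernel of a linear map depending polynomially on `x`, and its dimension on the stratum is minimal at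
`x = y` (`IsInfinitesimallyTransitive.finrank_ker_le`). Hence the identity of `y` extends to
homomorphisms `y → x` polynomial in `x` (`exists_kernel_section`); where they are invertible, `x`
lies in the orbit.

For density, the line from `C` to some `C'` equivalent to `M` stays in the stratum and meets the
open orbit for all but finitely many parameters. As `K` is infinite, `C` is in the closure. -/

/-! ### Homomorphisms of `⨁ J_r` as polynomial matrices -/

section PolynomialMatrices

open Polynomial

variable {K : Type*} [Field K]

/-- A polynomial matrix whose entries define homomorphisms `J_{p_j} → J_{q_i}`. -/
def IsHomMatrix {s r : ℕ} (p : Fin s → ℕ) (q : Fin r → ℕ) (N : Matrix (Fin r) (Fin s) K[X]) :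
    Prop :=
  ∀ i j, (X : K[X]) ^ q i ∣ N i j * X ^ p j

/-- The class in `⨁ j, J_{p_j}` of a vector of polynomials. -/
noncomputable def jVec {s : ℕ} (p : Fin s → ℕ) (f : Fin s → K[X]) : (j : Fin s) → JModule K (p j) :=
  fun j => Ideal.Quotient.mk _ (f j)

theorem jVec_surjective {s : ℕ} (p : Fin s → ℕ) :
    Function.Surjective (jVec (K := K) p) := by
  intro v
  choose f hf using fun j => Ideal.Quotient.mk_surjective (v j)
  exact ⟨f, funext hf⟩

theorem jVec_add {s : ℕ} (p : Fin s → ℕ) (f g : Fin s → K[X]) :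
    jVec p (f + g) = jVec p f + jVec p g := by
  ext j; simp [jVec]

theorem jVec_sub {s : ℕ} (p : Fin s → ℕ) (f g : Fin s → K[X]) :
    jVec p (f - g) = jVec p f - jVec p g := by
  ext j; simp [jVec]

theorem jVec_smul {s : ℕ} (p : Fin s → ℕ) (a : K[X]) (f : Fin s → K[X]) :
    jVec p (a • f) = a • jVec p f := by
  ext j
  simp only [jVec, Pi.smul_apply, smul_eq_mul, map_mul]
  rfl

theorem jVec_eq_zero_iff {s : ℕ} (p : Fin s → ℕ) (f : Fin s → K[X]) :
    jVec p f = 0 ↔ ∀ j, (X : K[X]) ^ p j ∣ f j := by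
  simp only [funext_iff, jVec, Pi.zero_apply, Ideal.Quotient.eq_zero_iff_mem,
    Ideal.mem_span_singleton]

theorem jVec_eq_iff {s : ℕ} (p : Fin s → ℕ) (f g : Fin s → K[X]) :
    jVec p f = jVec p g ↔ ∀ j, (X : K[X]) ^ p j ∣ f j - g j := by
  rw [← sub_eq_zero, ← jVec_sub, jVec_eq_zero_iff]; rfl

/-- The divisibility condition is what makes multiplication by `N` independent of the
representatives. -/
theorem IsHomMatrix.exists_linearMap {s r : ℕ} {p : Fin s → ℕ} {q : Fin r → ℕ}
    {N : Matrix (Fin r) (Fin s) K[X]} (hN : IsHomMatrix p q N) :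
    ∃ F : ((j : Fin s) → JModule K (p j)) →ₗ[K[X]] ((i : Fin r) → JModule K (q i)),
      ∀ f, F (jVec p f) = jVec q (N.mulVec f) := by
  have key : ∀ f g, jVec p f = jVec p g → jVec q (N.mulVec f) = jVec q (N.mulVec g) := by
    intro f g h
    rw [jVec_eq_iff] at h ⊢
    intro i
    change X ^ q i ∣ (N.mulVec f - N.mulVec g) i
    rw [← Matrix.mulVec_sub, Matrix.mulVec, dotProduct]
    refine Finset.dvd_sum fun j _ => ?_
    obtain ⟨c, hc⟩ := h j
    rw [Pi.sub_apply, hc, ← mul_assoc]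
    exact (hN i j).mul_right c
  choose σ hσ using jVec_surjective (K := K) p
  have hF : ∀ f, jVec q (N.mulVec (σ (jVec p f))) = jVec q (N.mulVec f) :=
    fun f => key _ _ (hσ _)
  refine ⟨{ toFun := fun v => jVec q (N.mulVec (σ v)), map_add' := ?_, map_smul' := ?_ }, hF⟩
  · intro v w
    obtain ⟨f, rfl⟩ := jVec_surjective p v
    obtain ⟨g, rfl⟩ := jVec_surjective p w
    rw [← jVec_add, hF, hF, hF, Matrix.mulVec_add, jVec_add]
  · intro a v
    obtain ⟨f, rfl⟩ := jVec_surjective p v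
    rw [← jVec_smul, hF, hF, Matrix.mulVec_smul, jVec_smul, RingHom.id_apply]

/-- Every homomorphism between direct sums of modules `J_r` is given by a polynomial matrix. -/
theorem exists_isHomMatrix {s r : ℕ} {p : Fin s → ℕ} {q : Fin r → ℕ}
    (F : ((j : Fin s) → JModule K (p j)) →ₗ[K[X]] ((i : Fin r) → JModule K (q i))) :
    ∃ N : Matrix (Fin r) (Fin s) K[X], IsHomMatrix p q N ∧
      ∀ f, F (jVec p f) = jVec q (N.mulVec f) := by
  choose σ hσ using jVec_surjective (K := K) q
  let N : Matrix (Fin r) (Fin s) K[X] :=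
    Matrix.of fun i j => σ (F (jVec p (Pi.single j 1))) i
  have hcol : ∀ j, N.col j = σ (F (jVec p (Pi.single j 1))) := fun j => rfl
  have hN : ∀ f, F (jVec p f) = jVec q (N.mulVec f) := by
    intro f
    have hsum : ∀ (r' : ℕ) (q' : Fin r' → ℕ) (g : Fin s → Fin r' → K[X]),
        jVec q' (∑ j, g j) = ∑ j, jVec q' (g j) := by
      intro r' q' g
      let φ : (Fin r' → K[X]) →+ ((i : Fin r') → JModule K (q' i)) :=
        AddMonoidHom.mk' (jVec q') (jVec_add q')
      exact map_sum φ g _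
    have h1 : f = ∑ j, f j • (Pi.single j 1 : Fin s → K[X]) := by
      ext i; simp [Finset.sum_apply, Pi.single_apply]
    have h2 : N.mulVec f = ∑ j, f j • N.col j := by
      ext1 i
      simp only [Matrix.mulVec, dotProduct, Finset.sum_apply, Pi.smul_apply, Matrix.col_apply,
        smul_eq_mul, mul_comm]
    rw [h2, hsum]
    conv_lhs => rw [h1]
    rw [hsum, map_sum]
    refine Finset.sum_congr rfl fun j _ => ?_
    rw [jVec_smul, jVec_smul, map_smul, hcol, hσ]
  refine ⟨N, fun i j => ?_, hN⟩
  have h0 : jVec p ((X : K[X]) ^ p j • (Pi.single j 1 : Fin s → K[X])) = 0 := by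
    rw [jVec_eq_zero_iff]
    intro j'
    rcases eq_or_ne j' j with rfl | h <;> simp [*]
  have h1 := hN ((X : K[X]) ^ p j • (Pi.single j 1 : Fin s → K[X]))
  rw [h0, map_zero, eq_comm, jVec_eq_zero_iff] at h1
  have := h1 i
  rw [Matrix.mulVec_smul, Matrix.mulVec_single_one] at this
  rwa [mul_comm]

/-! ### The tangent space to the orbit of the staircase matrix -/

/-- The matrices `H M - M G` with `H` and `G` endomorphism matrices of `⨁ i, J_{q_i}` and
`⨁ j, J_{p_j}`. -/
def tangentMatrices {s r : ℕ} (p : Fin s → ℕ) (q : Fin r → ℕ) (M : Matrix (Fin r) (Fin s) K[X]) :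
    Submodule K[X] (Matrix (Fin r) (Fin s) K[X]) where
  carrier := {Z | ∃ (H : Matrix (Fin r) (Fin r) K[X]) (G : Matrix (Fin s) (Fin s) K[X]),
    IsHomMatrix q q H ∧ IsHomMatrix p p G ∧ Z = H * M - M * G}
  zero_mem' := ⟨0, 0, fun i j => by simp, fun i j => by simp, by simp⟩
  add_mem' := by
    rintro _ _ ⟨H, G, hH, hG, rfl⟩ ⟨H', G', hH', hG', rfl⟩
    refine ⟨H + H', G + G', fun i j => ?_, fun i j => ?_, ?_⟩
    · rw [Matrix.add_apply, add_mul]; exact dvd_add (hH i j) (hH' i j)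
    · rw [Matrix.add_apply, add_mul]; exact dvd_add (hG i j) (hG' i j)
    · rw [Matrix.add_mul, Matrix.mul_add]; abel
  smul_mem' := by
    rintro c _ ⟨H, G, hH, hG, rfl⟩
    refine ⟨c • H, c • G, fun i j => ?_, fun i j => ?_, ?_⟩
    · rw [Matrix.smul_apply, smul_eq_mul, mul_assoc]; exact (hH i j).mul_left c
    · rw [Matrix.smul_apply, smul_eq_mul, mul_assoc]; exact (hG i j).mul_left c
    · rw [Matrix.smul_mul, Matrix.mul_smul, smul_sub]

theorem isHomMatrix_single {s r : ℕ} {p : Fin s → ℕ} {q : Fin r → ℕ} {a : Fin r} {b : Fin s}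
    {f : K[X]} (h : X ^ q a ∣ f * X ^ p b) : IsHomMatrix p q (Matrix.single a b f) := by
  intro i j
  by_cases hij : a = i ∧ b = j
  · obtain ⟨rfl, rfl⟩ := hij
    simpa using h
  · rw [Matrix.single_apply, if_neg hij, zero_mul]
    exact dvd_zero _

/-- The matrix with single nonzero entry `T^*`, in row `i` and column `j` counted from the bottom
right corner; it is zero if there is no such position. -/
noncomputable def starEntry {s r : ℕ} (p : Fin s → ℕ) (q : Fin r → ℕ) (i j : ℕ) :
    Matrix (Fin r) (Fin s) K[X] :=
  Matrix.of fun a b => if (a.rev : ℕ) = i ∧ (b.rev : ℕ) = j then tStar K (q a) (p b) else 0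

/-- Vanishing outside the matrix lets the induction along the staircase ignore its borders. -/
theorem starEntry_eq_zero {s r : ℕ} (p : Fin s → ℕ) (q : Fin r → ℕ) {i j : ℕ}
    (h : r ≤ i ∨ s ≤ j) : starEntry (K := K) p q i j = 0 := by
  refine Matrix.ext fun a b => ?_
  have ha := a.rev.isLt
  have hb := b.rev.isLt
  simp only [starEntry, Matrix.of_apply, Matrix.zero_apply]
  rw [if_neg (by omega)]

/-- Since `2 ≤ i`, no subtraction of exponents is truncated. -/
theorem tStar_row {i i' j : ℕ} (hi : 2 ≤ i) (h : i ≤ i') :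
    X ^ (i' - i) * tStar K i j = tStar K i' j := by
  unfold tStar
  split_ifs <;> rw [← pow_add] <;> congr 1 <;> omega

variable {k l : ℕ} {p : Fin (k + 1) → ℕ} {q : Fin l → ℕ}

/-- Row operation: row `i'`, whose entries sit in columns `i'` and `i' + 1`, is moved to row `i`
along the embedding of `J_{q_{i'}}` into the longer `J_{q_i}`. -/
theorem starEntry_row_mem (hq : Antitone q) (hq_two : ∀ i, 2 ≤ q i) {i i' : ℕ} (h : i' ≤ i) :
    starEntry p q i i' + starEntry p q i (i' + 1) ∈
      tangentMatrices p q (staircase K p q) := by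
  by_cases hi : i < l
  swap
  · rw [starEntry_eq_zero _ _ (.inl (by omega)), starEntry_eq_zero _ _ (.inl (by omega)), add_zero]
    exact zero_mem _
  let a : Fin l := Fin.rev ⟨i, hi⟩
  let a' : Fin l := Fin.rev ⟨i', by omega⟩
  have hle : q a' ≤ q a := hq (by simp only [a, a', Fin.rev_le_rev]; exact h)
  refine ⟨Matrix.single a a' (X ^ (q a - q a')), 0, isHomMatrix_single ?_, fun i j => by simp, ?_⟩
  · rw [← pow_add, Nat.sub_add_cancel hle]
  refine Matrix.ext fun x y => ?_
  have ha' : (a'.rev : ℕ) = i' := by simp only [a', Fin.rev_rev]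
  have hxa : (x.rev : ℕ) = i ↔ x = a := by
    rw [← Fin.rev_inj, Fin.ext_iff]; simp only [a, Fin.rev_rev]
  rw [Matrix.mul_zero, sub_zero, Matrix.add_apply]
  simp only [starEntry, Matrix.of_apply, hxa]
  by_cases hx : x = a
  · subst hx
    rw [Matrix.single_mul_apply_same]
    simp only [staircase, Matrix.of_apply, ha', mul_ite, mul_zero, tStar_row (hq_two _) hle]
    by_cases h1 : (y.rev : ℕ) = i'
    · simp [h1, -Fin.val_rev]
    · simp [h1, -Fin.val_rev]
  · rw [Matrix.single_mul_apply_of_ne (h := hx)]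
    simp [hx]

/-- Column operation: column `j' + 1`, whose entries sit in rows `j'` and `j' + 1`, is moved to
column `j` along the projection of `J_{p_j}` onto the shorter `J_{p_{j'+1}}`. Neither is column `0`,
so both labels are at least `3` and `T^*` is the same power in both. -/
theorem starEntry_col_mem (hp : Antitone p) (hp_three : ∀ j : Fin k, 3 ≤ p j.castSucc)
    {j j' : ℕ} (h : j' + 1 ≤ j) :
    starEntry p q j' j + starEntry p q (j' + 1) j ∈
      tangentMatrices p q (staircase K p q) := by
  by_cases hj : j < k + 1
  swap
  · rw [starEntry_eq_zero _ _ (.inr (by omega)), starEntry_eq_zero _ _ (.inr (by omega)), add_zero]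
    exact zero_mem _
  let b : Fin (k + 1) := Fin.rev ⟨j, hj⟩
  let b' : Fin (k + 1) := Fin.rev ⟨j' + 1, by omega⟩
  have hle : p b' ≤ p b := hp (by simp only [b, b', Fin.rev_le_rev]; exact h)
  have hb3 : 3 ≤ p b' := by
    have hlt : (b' : ℕ) < k := by simp only [b', Fin.val_rev]; omega
    exact hp_three ⟨b', hlt⟩
  refine ⟨0, Matrix.single b' b (-1), fun i j => by simp, isHomMatrix_single ?_, ?_⟩
  · exact (pow_dvd_pow _ hle).mul_left _
  refine Matrix.ext fun x y => ?_
  have hb' : (b'.rev : ℕ) = j' + 1 := by simp only [b', Fin.rev_rev]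
  have hyb : (y.rev : ℕ) = j ↔ y = b := by
    rw [← Fin.rev_inj, Fin.ext_iff]; simp only [b, Fin.rev_rev]
  rw [Matrix.zero_mul, zero_sub, Matrix.neg_apply, Matrix.add_apply]
  simp only [starEntry, Matrix.of_apply, hyb]
  by_cases hy : y = b
  · subst hy
    rw [Matrix.mul_single_apply_same]
    have ht : tStar K (q x) (p b') = tStar K (q x) (p b) := by
      unfold tStar
      rw [if_neg (by omega), if_neg (by omega)]
    simp only [staircase, Matrix.of_apply, hb', ht]
    by_cases h1 : (x.rev : ℕ) = j'
    · simp [h1, -Fin.val_rev]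
    · have h2 : ¬ (j' = (x.rev : ℕ)) := fun h => h1 h.symm
      by_cases h3 : (x.rev : ℕ) = j' + 1
      · simp [h3, -Fin.val_rev]
      · have h4 : ¬ (j' + 1 = (x.rev : ℕ)) := fun h => h3 h.symm
        simp [h1, h2, h3, h4, -Fin.val_rev]
  · rw [Matrix.mul_single_apply_of_ne (hbj := hy)]
    simp [hy]

/-- Column `0` of the staircase has no entry outside row `0`, so rescaling this column isolates the
corner. This starts the induction. -/
theorem starEntry_zero_mem :
    starEntry p q 0 0 ∈ tangentMatrices p q (staircase K p q) := by
  refine ⟨0, Matrix.single (Fin.last k) (Fin.last k) (-1), fun i j => by simp,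
    isHomMatrix_single (dvd_mul_left _ _), ?_⟩
  refine Matrix.ext fun x y => ?_
  rw [Matrix.zero_mul, zero_sub, Matrix.neg_apply]
  have hy' : (y.rev : ℕ) = 0 ↔ y = Fin.last k := by
    rw [Fin.ext_iff, Fin.val_rev, Fin.val_last]; omega
  simp only [starEntry, Matrix.of_apply, hy']
  by_cases hy : y = Fin.last k
  · subst hy
    rw [Matrix.mul_single_apply_same]
    by_cases h1 : (x.rev : ℕ) = 0
    · simp [staircase, h1, -Fin.val_rev]
    · have h2 : ¬ (0 = (x.rev : ℕ)) := fun h => h1 h.symm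
      simp [staircase, h1, h2, -Fin.val_rev]
  · rw [Matrix.mul_single_apply_of_ne (hbj := hy)]
    simp [hy]

/-- The staircase is climbed by `(i, i) → (i, i + 1) → (i + 1, i + 1)`, alternating row and column
operations: each gives the sum of a known position and the next one. -/
theorem starEntry_mem (hp : Antitone p) (hq : Antitone q)
    (hp_three : ∀ j : Fin k, 3 ≤ p j.castSucc) (hq_two : ∀ i, 2 ≤ q i) (i j : ℕ) :
    starEntry p q i j ∈ tangentMatrices p q (staircase K p q) := by
  set S := tangentMatrices p q (staircase K p q)
  have hdiag : ∀ i, starEntry p q i i ∈ S ∧ starEntry p q i (i + 1) ∈ S := by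
    intro i
    induction i with
    | zero =>
      exact ⟨starEntry_zero_mem,
        (Submodule.add_mem_iff_right _ starEntry_zero_mem).1
          (starEntry_row_mem hq hq_two le_rfl)⟩
    | succ i ih =>
      have h := (Submodule.add_mem_iff_right _ ih.2).1
        (starEntry_col_mem hp hp_three (le_refl (i + 1)))
      exact ⟨h, (Submodule.add_mem_iff_right _ h).1 (starEntry_row_mem hq hq_two le_rfl)⟩
  -- Off the staircase, row operations move from `(i, i)` towards smaller columns, and column
  -- operations from `(j, j)` towards smaller rows.
  rcases le_total j i with h | h
  · exact Nat.decreasingInduction (motive := fun j _ => starEntry p q i j ∈ S)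
      (fun j hj ih => (Submodule.add_mem_iff_left _ ih).1
        (starEntry_row_mem hq hq_two hj.le)) (hdiag i).1 h
  · exact Nat.decreasingInduction (motive := fun i _ => starEntry p q i j ∈ S)
      (fun i hi ih => (Submodule.add_mem_iff_left _ ih).1
        (starEntry_col_mem hp hp_three hi)) (hdiag j).1 h

/-- Every homomorphism matrix killed by `T ^ 2` is of the form `H M - M G`, where `M` is the
staircase matrix. -/
theorem mem_tangentMatrices_staircase (hp : Antitone p) (hq : Antitone q)
    (hp_three : ∀ j : Fin k, 3 ≤ p j.castSucc) (hq_two : ∀ i, 2 ≤ q i)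
    {Z : Matrix (Fin l) (Fin (k + 1)) K[X]} (hZ : IsHomMatrix p q Z)
    (hZ2 : ∀ i j, X ^ q i ∣ X ^ 2 * Z i j) :
    Z ∈ tangentMatrices p q (staircase K p q) := by
  -- In a column labeled `J_1` being a homomorphism already forces `T ^ (q_i - 1)`; in the others,
  -- being killed by `T ^ 2` forces `T ^ (q_i - 2)`.
  have hdvd : ∀ i j, tStar K (q i) (p j) ∣ Z i j := by
    intro i j
    have hX : (X : K[X]) ≠ 0 := X_ne_zero
    unfold tStar
    split_ifs with h
    · have h1 := hZ i j
      rw [h, pow_one, mul_comm, ← Nat.sub_add_cancel (show 1 ≤ q i by have := hq_two i; omega),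
        pow_succ'] at h1
      exact (mul_dvd_mul_iff_left hX).1 h1
    · have h1 := hZ2 i j
      rw [← Nat.sub_add_cancel (hq_two i), add_comm, pow_add] at h1
      rw [show q i - 2 = q i - 2 + 2 - 2 by omega]
      exact (mul_dvd_mul_iff_left (pow_ne_zero 2 hX)).1 h1
  choose c hc using hdvd
  have hsum : Z = ∑ i : Fin l, ∑ j : Fin (k + 1), c i j • starEntry p q (i.rev : ℕ) (j.rev : ℕ) := by
    refine Matrix.ext fun a b => ?_
    rw [Matrix.sum_apply, Finset.sum_eq_single a, Matrix.sum_apply, Finset.sum_eq_single b]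
    · simp [starEntry, hc a b, mul_comm]
    · intro j _ hj
      have : ¬ ((b.rev : ℕ) = (j.rev : ℕ)) := by
        rw [← Fin.ext_iff, Fin.rev_inj]; exact fun h => hj h.symm
      simp [starEntry, this, -Fin.val_rev]
    · simp
    · intro i _ hi
      have : ¬ ((a.rev : ℕ) = (i.rev : ℕ)) := by
        rw [← Fin.ext_iff, Fin.rev_inj]; exact fun h => hi h.symm
      rw [Matrix.sum_apply]
      simp [starEntry, this, -Fin.val_rev]
    · simp
  rw [hsum]
  exact Submodule.sum_mem _ fun i _ => Submodule.sum_mem _ fun j _ =>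
    Submodule.smul_mem _ _ (starEntry_mem hp hq hp_three hq_two _ _)

theorem isHomMatrix_staircase (hp_last : p (Fin.last k) = 1)
    (hp_three : ∀ j : Fin k, 3 ≤ p j.castSucc) (hq_two : ∀ i, 2 ≤ q i) :
    IsHomMatrix p q (staircase K p q) := by
  intro i j
  have hi := hq_two i
  simp only [staircase, Matrix.of_apply, tStar]
  split_ifs with h h1
  · rw [← pow_add]; exact pow_dvd_pow _ (by omega)
  · have hj : 3 ≤ p j := by
      induction j using Fin.lastCases with
      | last => exact absurd hp_last h1
      | cast j => exact hp_three j
    rw [← pow_add]; exact pow_dvd_pow _ (by omega)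
  · simp

theorem sq_dvd_staircase (hq_two : ∀ i, 2 ≤ q i) (i : Fin l) (j : Fin (k + 1)) :
    X ^ q i ∣ X ^ 2 * staircase K p q i j := by
  have hi := hq_two i
  simp only [staircase, Matrix.of_apply, tStar]
  split_ifs
  · rw [← pow_add]; exact pow_dvd_pow _ (by omega)
  · rw [← pow_add]; exact pow_dvd_pow _ (by omega)
  · simp

end PolynomialMatrices

/-! ### Matrices as `K[T]`-modules -/

section MatrixModules

open Polynomial

variable {K : Type*} [Field K]

/-- A column vector as an element of the `K[T]`-module defined by the matrix `A`. -/
abbrev toModule {d : ℕ} (A : Matrix (Fin d) (Fin d) K) : (Fin d → K) ≃ₗ[K] matrixModule A :=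
  Module.AEval'.of (Matrix.toLin' A)

theorem X_pow_smul_toModule {d : ℕ} (A : Matrix (Fin d) (Fin d) K) (n : ℕ) (v : Fin d → K) :
    (X ^ n : K[X]) • toModule A v = toModule A ((A ^ n).mulVec v) := by
  rw [Module.AEval'.X_pow_smul_of, ← Matrix.toLin'_pow]
  rfl

theorem X_smul_toModule {d : ℕ} (A : Matrix (Fin d) (Fin d) K) (v : Fin d → K) :
    (X : K[X]) • toModule A v = toModule A (A.mulVec v) := by
  simpa using X_pow_smul_toModule A 1 v

theorem matrix_ext_mulVec {d e : ℕ} {Y Z : Matrix (Fin e) (Fin d) K}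
    (h : ∀ v, Y.mulVec v = Z.mulVec v) : Y = Z :=
  Matrix.toLin'.injective (LinearMap.ext h)

/-- A `K[T]`-linear map between matrix modules is given by an intertwining matrix. -/
theorem exists_matrix_of_linearMap {d e : ℕ} {A : Matrix (Fin d) (Fin d) K}
    {B : Matrix (Fin e) (Fin e) K} (F : matrixModule A →ₗ[K[X]] matrixModule B) :
    ∃ Z : Matrix (Fin e) (Fin d) K, Z * A = B * Z ∧
      ∀ v, F (toModule A v) = toModule B (Z.mulVec v) := by
  let G : (Fin d → K) →ₗ[K] (Fin e → K) :=
    (toModule B).symm.toLinearMap ∘ₗ (F.restrictScalars K) ∘ₗ (toModule A).toLinearMap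
  have hG : ∀ v, (LinearMap.toMatrix' G).mulVec v = (toModule B).symm (F (toModule A v)) := by
    intro v
    rw [← Matrix.toLin'_apply, Matrix.toLin'_toMatrix']
    rfl
  refine ⟨LinearMap.toMatrix' G, matrix_ext_mulVec fun v => ?_, fun v => ?_⟩
  · apply (toModule B).injective
    rw [← Matrix.mulVec_mulVec, ← Matrix.mulVec_mulVec, ← X_smul_toModule, hG, hG,
      ← X_smul_toModule, map_smul, LinearEquiv.apply_symm_apply, LinearEquiv.apply_symm_apply]
  · rw [hG, LinearEquiv.apply_symm_apply]

/-- An intertwining matrix defines a `K[T]`-linear map between matrix modules. -/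
theorem exists_linearMap_of_matrix {d e : ℕ} {A : Matrix (Fin d) (Fin d) K}
    {B : Matrix (Fin e) (Fin e) K} {Z : Matrix (Fin e) (Fin d) K} (hZ : Z * A = B * Z) :
    ∃ F : matrixModule A →ₗ[K[X]] matrixModule B,
      ∀ v, F (toModule A v) = toModule B (Z.mulVec v) := by
  refine ⟨LinearMap.ofAEval _ ((toModule B).toLinearMap ∘ₗ Matrix.toLin' Z) ?_, fun v => rfl⟩
  intro v
  change toModule B (Z.mulVec (A.mulVec v)) = (X : K[X]) • toModule B (Z.mulVec v)
  rw [X_smul_toModule, Matrix.mulVec_mulVec, Matrix.mulVec_mulVec, hZ]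

theorem exists_GL_of_linearEquiv {d : ℕ} {A B : Matrix (Fin d) (Fin d) K}
    (e : matrixModule A ≃ₗ[K[X]] matrixModule B) :
    ∃ g : GL (Fin d) K, g.val * A = B * g.val ∧
      ∀ v, e (toModule A v) = toModule B (g.val.mulVec v) := by
  obtain ⟨Y, hY, hYe⟩ := exists_matrix_of_linearMap e.toLinearMap
  obtain ⟨Z, hZ, hZe⟩ := exists_matrix_of_linearMap e.symm.toLinearMap
  simp only [LinearEquiv.coe_coe] at hYe hZe
  have h1 : Z * Y = 1 := matrix_ext_mulVec fun v => (toModule A).injective <| by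
    rw [← Matrix.mulVec_mulVec, ← hZe, ← hYe, LinearEquiv.symm_apply_apply, Matrix.one_mulVec]
  exact ⟨⟨Y, Z, mul_eq_one_comm.1 h1, h1⟩, hY, hYe⟩

theorem exists_linearEquiv_of_GL {d : ℕ} {A B : Matrix (Fin d) (Fin d) K}
    (g : GL (Fin d) K) (hg : g.val * A = B * g.val) :
    ∃ e : matrixModule A ≃ₗ[K[X]] matrixModule B,
      ∀ v, e (toModule A v) = toModule B (g.val.mulVec v) := by
  obtain ⟨F, hF⟩ := exists_linearMap_of_matrix hg
  have hg' : (g⁻¹).val * B = A * (g⁻¹).val := by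
    calc (g⁻¹).val * B = (g⁻¹).val * (B * g.val) * (g⁻¹).val := by
          rw [Matrix.mul_assoc, Matrix.mul_assoc, Units.mul_inv, Matrix.mul_one]
      _ = A * (g⁻¹).val := by rw [← hg, ← Matrix.mul_assoc, Units.inv_mul, Matrix.one_mul]
  obtain ⟨F', hF'⟩ := exists_linearMap_of_matrix hg'
  refine ⟨LinearEquiv.ofLinearMap F F' ?_ ?_, hF⟩
  · ext v
    obtain ⟨v, rfl⟩ := (toModule B).surjective v
    rw [LinearMap.comp_apply, hF', hF, Matrix.mulVec_mulVec, Units.mul_inv, Matrix.one_mulVec]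
    rfl
  · ext v
    obtain ⟨v, rfl⟩ := (toModule A).surjective v
    rw [LinearMap.comp_apply, hF, hF', Matrix.mulVec_mulVec, Units.inv_mul, Matrix.one_mulVec]
    rfl

theorem HasType.exists_GL {d r : ℕ} {A B : Matrix (Fin d) (Fin d) K} {p : Fin r → ℕ}
    (hA : HasType A p) (hB : HasType B p) : ∃ g : GL (Fin d) K, g.val * A = B * g.val := by
  obtain ⟨φ⟩ := hA
  obtain ⟨ψ⟩ := hB
  obtain ⟨g, hg, -⟩ := exists_GL_of_linearEquiv (φ.trans ψ.symm)
  exact ⟨g, hg⟩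

theorem finrank_JModule_pi {r : ℕ} (p : Fin r → ℕ) :
    Module.Finite K ((i : Fin r) → JModule K (p i)) ∧
      Module.finrank K ((i : Fin r) → JModule K (p i)) = ∑ i, p i := by
  have hfin : ∀ i, Module.Finite K (JModule K (p i)) := fun i =>
    (monic_X_pow (R := K) (p i)).finite_quotient
  refine ⟨inferInstance, ?_⟩
  rw [Module.finrank_pi_fintype]
  refine Finset.sum_congr rfl fun i _ => ?_
  rw [finrank_quotient_span_eq_natDegree, natDegree_X_pow]

/-- The matrix is that of multiplication by `T` in a `K`-basis of `⨁ J_{p_i}`. -/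
theorem exists_hasType {d r : ℕ} (p : Fin r → ℕ) (hd : ∑ i, p i = d) :
    ∃ A : Matrix (Fin d) (Fin d) K, HasType A p := by
  obtain ⟨hfin, hrank⟩ := finrank_JModule_pi (K := K) p
  rw [hd] at hrank
  let b : Module.Basis (Fin d) K ((i : Fin r) → JModule K (p i)) :=
    Module.finBasisOfFinrankEq K _ hrank
  let T : ((i : Fin r) → JModule K (p i)) →ₗ[K] ((i : Fin r) → JModule K (p i)) :=
    (LinearMap.lsmul K[X] _ (X : K[X])).restrictScalars K
  refine ⟨LinearMap.toMatrix b b T, ⟨LinearEquiv.ofAEval _ b.equivFun.symm fun v => ?_⟩⟩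
  change b.equivFun.symm ((LinearMap.toMatrix b b T).mulVec v) = T (b.equivFun.symm v)
  rw [LinearEquiv.symm_apply_eq]
  conv_lhs => rw [← b.equivFun.apply_symm_apply v]
  exact LinearMap.toMatrix_mulVec_repr b b T _

end MatrixModules

/-! ### Equivalence to a polynomial matrix and orbits -/

section Equivalence

open Polynomial

variable {K : Type*} [Field K] {d₁ d₂ s r : ℕ} {p : Fin s → ℕ} {q : Fin r → ℕ}
  {N : Matrix (Fin r) (Fin s) K[X]}

/-- A form free of inverse maps, convenient for composing isomorphisms. -/
theorem isEquivalentTo_iff {x : QuiverRep K d₁ d₂} :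
    IsEquivalentTo x p q N ↔
      ∃ (φ : matrixModule x.A ≃ₗ[K[X]] ((j : Fin s) → JModule K (p j)))
        (ψ : matrixModule x.B ≃ₗ[K[X]] ((i : Fin r) → JModule K (q i))),
        ∀ v f, φ (toModule x.A v) = jVec p f →
          ψ (toModule x.B (x.C.mulVec v)) = jVec q (N.mulVec f) := by
  constructor
  · rintro ⟨φ, ψ, h⟩
    refine ⟨φ, ψ, fun v f hv => ?_⟩
    rw [← LinearEquiv.eq_symm_apply, ← LinearEquiv.eq_symm_apply] at hv
    rw [hv]
    exact h f
  · rintro ⟨φ, ψ, h⟩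
    refine ⟨φ, ψ, fun f => h _ f ?_⟩
    rw [LinearEquiv.apply_symm_apply, LinearEquiv.apply_symm_apply]
    rfl

theorem mem_orbit_of_intertwines {x y : QuiverRep K d₁ d₂} (g : GL (Fin d₁) K)
    (h : GL (Fin d₂) K) (hA : g.val * y.A = x.A * g.val) (hB : h.val * y.B = x.B * h.val)
    (hC : h.val * y.C = x.C * g.val) :
    x ∈ MulAction.orbit (GL (Fin d₁) K × GL (Fin d₂) K) y := by
  refine ⟨(g, h), QuiverRep.ext ?_ ?_ ?_⟩
  · change g.val * y.A * (g⁻¹).val = x.A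
    rw [hA, Matrix.mul_assoc, Units.mul_inv, Matrix.mul_one]
  · change h.val * y.B * (h⁻¹).val = x.B
    rw [hB, Matrix.mul_assoc, Units.mul_inv, Matrix.mul_one]
  · change h.val * y.C * (g⁻¹).val = x.C
    rw [hC, Matrix.mul_assoc, Units.mul_inv, Matrix.mul_one]

theorem exists_intertwines_of_mem_orbit {x y : QuiverRep K d₁ d₂}
    (hx : x ∈ MulAction.orbit (GL (Fin d₁) K × GL (Fin d₂) K) y) :
    ∃ (g : GL (Fin d₁) K) (h : GL (Fin d₂) K), g.val * y.A = x.A * g.val ∧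
      h.val * y.B = x.B * h.val ∧ h.val * y.C = x.C * g.val := by
  obtain ⟨⟨g, h⟩, rfl⟩ := hx
  refine ⟨g, h, ?_, ?_, ?_⟩
  · change _ = g.val * y.A * (g⁻¹).val * g.val
    rw [Matrix.mul_assoc, Units.inv_mul, Matrix.mul_one]
  · change _ = h.val * y.B * (h⁻¹).val * h.val
    rw [Matrix.mul_assoc, Units.inv_mul, Matrix.mul_one]
  · change _ = h.val * y.C * (g⁻¹).val * g.val
    rw [Matrix.mul_assoc, Units.inv_mul, Matrix.mul_one]

theorem IsEquivalentTo.of_mem_orbit {x y : QuiverRep K d₁ d₂} (hy : IsEquivalentTo y p q N)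
    (hx : x ∈ MulAction.orbit (GL (Fin d₁) K × GL (Fin d₂) K) y) : IsEquivalentTo x p q N := by
  obtain ⟨g, h, hA, hB, hC⟩ := exists_intertwines_of_mem_orbit hx
  obtain ⟨e, he⟩ := exists_linearEquiv_of_GL g hA
  obtain ⟨e', he'⟩ := exists_linearEquiv_of_GL h hB
  rw [isEquivalentTo_iff] at hy ⊢
  obtain ⟨φ, ψ, hN⟩ := hy
  refine ⟨e.symm.trans φ, e'.symm.trans ψ, fun v f hv => ?_⟩
  obtain ⟨w, hw⟩ := (toModule y.A).surjective (e.symm (toModule x.A v))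
  rw [LinearEquiv.trans_apply, ← hw] at hv
  rw [LinearEquiv.trans_apply, ← hN w f hv]
  rw [LinearEquiv.eq_symm_apply, he] at hw
  rw [← (toModule x.A).injective hw, Matrix.mulVec_mulVec, ← hC, ← Matrix.mulVec_mulVec, ← he',
    LinearEquiv.symm_apply_apply]

theorem IsEquivalentTo.mem_orbit {x y : QuiverRep K d₁ d₂} (hx : IsEquivalentTo x p q N)
    (hy : IsEquivalentTo y p q N) :
    x ∈ MulAction.orbit (GL (Fin d₁) K × GL (Fin d₂) K) y := by
  rw [isEquivalentTo_iff] at hx hy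
  obtain ⟨φ, ψ, h⟩ := hy
  obtain ⟨φ', ψ', h'⟩ := hx
  obtain ⟨a, ha, hav⟩ := exists_GL_of_linearEquiv (φ.trans φ'.symm)
  obtain ⟨b, hb, hbv⟩ := exists_GL_of_linearEquiv (ψ.trans ψ'.symm)
  refine mem_orbit_of_intertwines a b ha hb (matrix_ext_mulVec fun v => ?_)
  obtain ⟨f, hf⟩ := jVec_surjective p (φ (toModule y.A v))
  apply (toModule x.B).injective
  apply ψ'.injective
  rw [← Matrix.mulVec_mulVec, ← hbv, ← Matrix.mulVec_mulVec, h' _ f, LinearEquiv.trans_apply,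
    LinearEquiv.apply_symm_apply, h _ _ hf.symm]
  rw [← hav, LinearEquiv.trans_apply, LinearEquiv.apply_symm_apply, hf]

theorem HasType.exists_isEquivalentTo {A : Matrix (Fin d₁) (Fin d₁) K}
    {B : Matrix (Fin d₂) (Fin d₂) K} (hA : HasType A p) (hB : HasType B q)
    (hN : IsHomMatrix p q N) :
    ∃ C : Matrix (Fin d₂) (Fin d₁) K, IsEquivalentTo ⟨A, B, C⟩ p q N := by
  obtain ⟨φ⟩ := hA
  obtain ⟨ψ⟩ := hB
  obtain ⟨F, hF⟩ := hN.exists_linearMap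
  obtain ⟨C, -, hC⟩ := exists_matrix_of_linearMap
    (ψ.symm.toLinearMap ∘ₗ F ∘ₗ φ.toLinearMap)
  refine ⟨C, isEquivalentTo_iff.2 ⟨φ, ψ, fun v f hv => ?_⟩⟩
  change ψ (toModule B (C.mulVec v)) = _
  rw [← hC, LinearMap.comp_apply, LinearMap.comp_apply, LinearEquiv.coe_coe, LinearEquiv.coe_coe,
    LinearEquiv.apply_symm_apply]
  exact (congrArg F hv).trans (hF f)

theorem HasType.pow_eq_zero {d : ℕ} {A : Matrix (Fin d) (Fin d) K} (hA : HasType A p) {e : ℕ}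
    (hp : ∀ j, p j ≤ e) : A ^ e = 0 := by
  obtain ⟨φ⟩ := hA
  refine matrix_ext_mulVec fun v => (toModule A).injective (φ.injective ?_)
  obtain ⟨f, hf⟩ := jVec_surjective p (φ (toModule A v))
  rw [← X_pow_smul_toModule, map_smul, ← hf, ← jVec_smul, Matrix.zero_mulVec, map_zero, map_zero,
    jVec_eq_zero_iff]
  exact fun j => (pow_dvd_pow _ (hp j)).mul_right _

/-- The relation `C A = B C` is `K[T]`-linearity of `N`, and `B ^ 2 C = 0` says that `T ^ 2` kills
it. -/
theorem IsEquivalentTo.mem_stratum {x : QuiverRep K d₁ d₂} (hx : IsEquivalentTo x p q N)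
    {m n : ℕ} (hp : ∀ j, p j ≤ m) (hq : ∀ i, q i ≤ n)
    (hN : ∀ i j, X ^ q i ∣ X ^ 2 * N i j) : x ∈ stratum K m n d₁ d₂ p q := by
  obtain ⟨φ, ψ, h⟩ := isEquivalentTo_iff.1 hx
  have hA : HasType x.A p := ⟨φ⟩
  have hB : HasType x.B q := ⟨ψ⟩
  refine ⟨⟨hA.pow_eq_zero hp, hB.pow_eq_zero hq, ?_, ?_⟩, hA, hB⟩
  · rw [sub_eq_zero]
    refine matrix_ext_mulVec fun v => (toModule x.B).injective (ψ.injective ?_)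
    obtain ⟨f, hf⟩ := jVec_surjective p (φ (toModule x.A v))
    rw [← Matrix.mulVec_mulVec, ← Matrix.mulVec_mulVec, ← X_smul_toModule, map_smul,
      h v f hf.symm, h _ ((X : K[X]) • f), Matrix.mulVec_smul, jVec_smul]
    rw [← X_smul_toModule, map_smul, ← hf, jVec_smul]
  · refine matrix_ext_mulVec fun v => (toModule x.B).injective (ψ.injective ?_)
    obtain ⟨f, hf⟩ := jVec_surjective p (φ (toModule x.A v))
    rw [← Matrix.mulVec_mulVec, ← X_pow_smul_toModule, map_smul, h v f hf.symm, ← jVec_smul,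
      Matrix.zero_mulVec, map_zero, map_zero, jVec_eq_zero_iff]
    intro i
    rw [Pi.smul_apply, smul_eq_mul, Matrix.mulVec, dotProduct, Finset.mul_sum]
    refine Finset.dvd_sum fun j _ => ?_
    rw [← mul_assoc]
    exact (hN i j).mul_right _

/-- If every homomorphism matrix killed by `T ^ 2` is of the form `H N - N G`, then the
corresponding statement holds for every triple equivalent to `N`. -/
theorem IsEquivalentTo.exists_eq_sub {y : QuiverRep K d₁ d₂} (hy : IsEquivalentTo y p q N)
    (hN : ∀ Z : Matrix (Fin r) (Fin s) K[X], IsHomMatrix p q Z →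
      (∀ i j, X ^ q i ∣ X ^ 2 * Z i j) → Z ∈ tangentMatrices p q N)
    {Z : Matrix (Fin d₂) (Fin d₁) K} (hZ : Z * y.A = y.B * Z) (hZ2 : y.B ^ 2 * Z = 0) :
    ∃ (g : Matrix (Fin d₁) (Fin d₁) K) (h : Matrix (Fin d₂) (Fin d₂) K),
      g * y.A = y.A * g ∧ h * y.B = y.B * h ∧ Z = h * y.C - y.C * g := by
  obtain ⟨φ, ψ, hφψ⟩ := isEquivalentTo_iff.1 hy
  obtain ⟨F, hF⟩ := exists_linearMap_of_matrix hZ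
  obtain ⟨z, hz, hzF⟩ := exists_isHomMatrix (ψ.toLinearMap ∘ₗ F ∘ₗ φ.symm.toLinearMap)
  simp only [LinearMap.comp_apply, LinearEquiv.coe_coe] at hzF
  obtain ⟨H, G, hH, hG, rfl⟩ := hN z hz <| by
    intro i j
    -- Evaluating at `T ^ 2 e_j` turns `B ^ 2 Z = 0` into divisibility of column `j`.
    have h1 := hzF ((X : K[X]) ^ 2 • Pi.single j 1)
    obtain ⟨v, hv⟩ := (toModule y.A).surjective (φ.symm (jVec p (Pi.single j 1)))
    rw [jVec_smul, map_smul, map_smul, map_smul, ← hv, hF, ← map_smul, X_pow_smul_toModule,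
      Matrix.mulVec_mulVec, hZ2, Matrix.zero_mulVec, map_zero, map_zero, eq_comm,
      jVec_eq_zero_iff] at h1
    have h2 := h1 i
    rwa [Matrix.mulVec_smul, Matrix.mulVec_single_one] at h2
  obtain ⟨FH, hFH⟩ := hH.exists_linearMap
  obtain ⟨FG, hFG⟩ := hG.exists_linearMap
  obtain ⟨g, hg, hgv⟩ := exists_matrix_of_linearMap
    (φ.symm.toLinearMap ∘ₗ FG ∘ₗ φ.toLinearMap)
  obtain ⟨h, hh, hhv⟩ := exists_matrix_of_linearMap
    (ψ.symm.toLinearMap ∘ₗ FH ∘ₗ ψ.toLinearMap)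
  simp only [LinearMap.comp_apply, LinearEquiv.coe_coe] at hgv hhv
  refine ⟨g, h, hg, hh, matrix_ext_mulVec fun v => (toModule y.B).injective (ψ.injective ?_)⟩
  obtain ⟨f, hf⟩ := jVec_surjective p (φ (toModule y.A v))
  have hgf : φ (toModule y.A (g.mulVec v)) = jVec p (G.mulVec f) := by
    rw [← hgv, LinearEquiv.apply_symm_apply, ← hf, hFG]
  have hhf : ψ (toModule y.B (h.mulVec (y.C.mulVec v))) = jVec q (H.mulVec (N.mulVec f)) := by
    rw [← hhv, LinearEquiv.apply_symm_apply, hφψ v f hf.symm, hFH]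
  rw [← hF, Matrix.sub_mulVec, map_sub, map_sub, ← Matrix.mulVec_mulVec, ← Matrix.mulVec_mulVec,
    hhf, hφψ _ _ hgf, ← jVec_sub, Matrix.mulVec_mulVec, Matrix.mulVec_mulVec, ← Matrix.sub_mulVec,
    ← hzF, hf, LinearEquiv.symm_apply_apply]

end Equivalence

/-! ### Sections of kernels of constant dimension -/

section ConstantRank

variable {K X : Type*} [Field K] {P : Subalgebra K (X → K)}

theorem det_mem_subalgebra {ι : Type*} [Fintype ι] [DecidableEq ι] {M : Matrix ι ι (X → K)}
    (hM : ∀ i j, M i j ∈ P) : M.det ∈ P := by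
  rw [Matrix.det_apply']
  refine sum_mem fun σ _ => mul_mem ?_ (prod_mem fun i _ => hM _ _)
  exact intCast_mem P _

theorem adjugate_mem_subalgebra {ι : Type*} [Fintype ι] [DecidableEq ι] {M : Matrix ι ι (X → K)}
    (hM : ∀ i j, M i j ∈ P) (i j : ι) : M.adjugate i j ∈ P := by
  rw [Matrix.adjugate_apply]
  refine det_mem_subalgebra fun a b => ?_
  rw [Matrix.updateRow_apply]
  split_ifs
  · rw [Pi.single_apply]
    split_ifs
    · exact one_mem P
    · exact zero_mem P
  · exact hM a b

/-- `G` projects onto the range of `L`, then applies a section of `L` over it. -/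
theorem LinearMap.exists_generalizedInverse {E F : Type*} [AddCommGroup E] [Module K E]
    [AddCommGroup F] [Module K F] (L : E →ₗ[K] F) :
    ∃ G : F →ₗ[K] E, L ∘ₗ G ∘ₗ L = L ∧ G ∘ₗ L ∘ₗ G = G := by
  obtain ⟨s, hs⟩ := L.rangeRestrict.exists_rightInverse_of_surjective L.range_rangeRestrict
  obtain ⟨π, hπ⟩ := (LinearMap.range L).subtype.exists_leftInverse_of_injective
    (Submodule.ker_subtype _)
  have hLs : ∀ w : LinearMap.range L, L (s w) = w := fun w =>
    congrArg Subtype.val (LinearMap.congr_fun hs w)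
  have hπw : ∀ w : LinearMap.range L, π w = w := fun w => LinearMap.congr_fun hπ w
  refine ⟨s ∘ₗ π, LinearMap.ext fun v => ?_, LinearMap.ext fun w => ?_⟩
  · change L (s (π (L v))) = L v
    rw [hLs, hπw ⟨L v, LinearMap.mem_range_self L v⟩]
  · change s (π (L (s (π w)))) = s (π w)
    rw [hLs, hπw]

/-- A kernel vector of `L y` extends to a kernel vector of `L x`, depending on `x` through
functions in `P`, where the determinant `D` does not vanish and the dimension of the kernel does
not drop. -/
theorem exists_kernel_section {E F : Type*} [AddCommGroup E] [Module K E] [FiniteDimensional K E]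
    [AddCommGroup F] [Module K F] (L : X → E →ₗ[K] F)
    (hL : ∀ (e : E) (ℓ : F →ₗ[K] K), (fun x => ℓ (L x e)) ∈ P)
    (y : X) (e₀ : E) (he₀ : L y e₀ = 0) :
    ∃ (D : X → K) (z : X → E), D ∈ P ∧ (∀ ℓ : E →ₗ[K] K, (fun x => ℓ (z x)) ∈ P) ∧
      D y = 1 ∧ z y = e₀ ∧
      ∀ x, D x ≠ 0 → Module.finrank K (LinearMap.ker (L y)) ≤
        Module.finrank K (LinearMap.ker (L x)) → L x (z x) = 0 := by
  obtain ⟨G, hG₁, hG₂⟩ := (L y).exists_generalizedInverse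
  let b := Module.finBasis K E
  -- On `ker (L x)` this is `1 - G ∘ L y`, which maps into `ker (L y)` because `L y ∘ G ∘ L y = L
  -- y`; at `x = y` it is the identity.
  let u : X → E →ₗ[K] E := fun x => LinearMap.id + G ∘ₗ (L x - L y)
  let M : Matrix (Fin (Module.finrank K E)) (Fin (Module.finrank K E)) (X → K) :=
    Matrix.of fun i j x => LinearMap.toMatrix b b (u x) i j
  have hM : ∀ i j, M i j ∈ P := by
    intro i j
    have h1 : M i j = (fun x => (b.coord i ∘ₗ G) (L x (b j))) +
        algebraMap K (X → K) (b.coord i (b j) - b.coord i (G (L y (b j)))) := by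
      funext x
      simp only [M, u, Matrix.of_apply, LinearMap.toMatrix_apply, Pi.add_apply,
        Pi.algebraMap_apply, Algebra.algebraMap_self, RingHom.id_apply, LinearMap.add_apply,
        LinearMap.id_apply, LinearMap.comp_apply, LinearMap.sub_apply, map_add, map_sub,
        Finsupp.add_apply, Finsupp.sub_apply, Module.Basis.coord_apply, Pi.sub_apply]
      ring
    rw [h1]
    exact add_mem (hL _ _) (P.algebraMap_mem _)
  have hMx : ∀ x, (Pi.evalRingHom (fun _ : X => K) x).mapMatrix M = LinearMap.toMatrix b b (u x) :=
    fun x => rfl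
  let c := b.equivFun e₀
  -- The adjugate replaces the inverse of `u x`, keeping the section polynomial at the price of a
  -- factor `det (u x)`.
  let z : X → E := fun x => b.equivFun.symm ((LinearMap.toMatrix b b (u x)).adjugate.mulVec c)
  have hD : ∀ x, M.det x = (LinearMap.toMatrix b b (u x)).det := by
    intro x
    rw [← hMx, ← RingHom.map_det]
    rfl
  have hadj : ∀ x i j, M.adjugate i j x = (LinearMap.toMatrix b b (u x)).adjugate i j := by
    intro x i j
    rw [← hMx, ← RingHom.map_adjugate]
    rfl
  have huy : u y = LinearMap.id := by simp [u]
  have huz : ∀ x, u x (z x) = M.det x • e₀ := by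
    intro x
    apply b.equivFun.injective
    have h1 := LinearMap.toMatrix_mulVec_repr b b (u x) (z x)
    have h2 : ⇑(b.repr (z x)) = (LinearMap.toMatrix b b (u x)).adjugate.mulVec c :=
      b.equivFun.apply_symm_apply _
    rw [h2, Matrix.mulVec_mulVec, Matrix.mul_adjugate, Matrix.smul_mulVec, Matrix.one_mulVec] at h1
    rw [map_smul, hD]
    exact h1.symm
  have hDy : M.det y = 1 := by
    rw [hD, huy, LinearMap.toMatrix_id, Matrix.det_one]
  refine ⟨M.det, z, det_mem_subalgebra hM, ?_, hDy, ?_, ?_⟩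
  · intro ℓ
    have h1 : (fun x => ℓ (z x)) = ∑ i, (∑ j, M.adjugate i j * algebraMap K (X → K) (c j)) *
        algebraMap K (X → K) (ℓ (b i)) := by
      funext x
      simp only [z, Module.Basis.equivFun_symm_apply, map_sum, map_smul, smul_eq_mul,
        Finset.sum_apply, Pi.mul_apply, Pi.algebraMap_apply, Algebra.algebraMap_self,
        RingHom.id_apply, hadj, Matrix.mulVec, dotProduct]
    rw [h1]
    exact sum_mem fun i _ => mul_mem (sum_mem fun j _ => mul_mem (adjugate_mem_subalgebra hM i j)
      (P.algebraMap_mem _)) (P.algebraMap_mem _)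
  · have h1 := huz y
    rwa [hDy, one_smul, huy] at h1
  · intro x hx hrank
    have hinj : ∀ v, u x v = 0 → v = 0 := by
      intro v hv
      have h1 := LinearMap.toMatrix_mulVec_repr b b (u x) v
      rw [hv, map_zero] at h1
      have h2 := Matrix.eq_zero_of_mulVec_eq_zero (by rwa [← hD]) h1
      exact b.repr.map_eq_zero_iff.1 (DFunLike.coe_injective h2)
    have hker : ∀ v ∈ LinearMap.ker (L x), u x v ∈ LinearMap.ker (L y) := by
      intro v hv
      rw [LinearMap.mem_ker] at hv ⊢
      have h1 : G (L y (G (L y v))) = G (L y v) := LinearMap.congr_fun hG₂ (L y v)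
      have h2 : L y (G (L y v)) = L y v := LinearMap.congr_fun hG₁ v
      simp [u, hv, h2]
    let R : LinearMap.ker (L x) →ₗ[K] LinearMap.ker (L y) := (u x).restrict hker
    have hR : Function.Injective R := by
      rw [← LinearMap.ker_eq_bot, LinearMap.ker_eq_bot']
      intro v hv
      exact Subtype.ext (hinj v (congrArg Subtype.val hv))
    have hR' : Function.Surjective R :=
      (LinearMap.injective_iff_surjective_of_finrank_eq_finrank
        (le_antisymm (LinearMap.finrank_le_finrank_of_injective hR) hrank)).1 hR
    obtain ⟨w, hw⟩ := hR' ⟨e₀, he₀⟩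
    have hw' : u x w = e₀ := congrArg Subtype.val hw
    -- Both sides have image `det (u x) • e₀` under the injective `u x`, so `z x` lies in `ker (L
    -- x)` with `w`.
    have hz : z x = M.det x • (w : E) := by
      rw [← sub_eq_zero]
      apply hinj
      rw [map_sub, huz, map_smul, hw', sub_self]
    rw [hz, map_smul, LinearMap.mem_ker.1 w.2, smul_zero]

end ConstantRank

/-! ### Regular functions, principal open sets and lines -/

section Zariski

open Polynomial

variable {K : Type*} [Field K] {d₁ d₂ : ℕ}

variable (K d₁ d₂) in
/-- The functions on the space of triples that are polynomial in the matrix entries. -/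
noncomputable def regularFunctions : Subalgebra K (QuiverRep K d₁ d₂ → K) :=
  (MvPolynomial.aeval (R := K)
    (fun (c : QuiverRep.Coord d₁ d₂) (x : QuiverRep K d₁ d₂) => x.coord c)).range

theorem aeval_coord_apply (f : MvPolynomial (QuiverRep.Coord d₁ d₂) K) (x : QuiverRep K d₁ d₂) :
    MvPolynomial.aeval (R := K)
      (fun (c : QuiverRep.Coord d₁ d₂) (x : QuiverRep K d₁ d₂) => x.coord c) f x =
        MvPolynomial.eval x.coord f := by
  have h := MvPolynomial.comp_aeval_apply
    (fun (c : QuiverRep.Coord d₁ d₂) (x : QuiverRep K d₁ d₂) => x.coord c)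
    (Pi.evalAlgHom K (fun _ : QuiverRep K d₁ d₂ => K) x) f
  rw [← MvPolynomial.coe_aeval_eq_eval]
  exact h

theorem mem_regularFunctions_iff {φ : QuiverRep K d₁ d₂ → K} :
    φ ∈ regularFunctions K d₁ d₂ ↔
      ∃ f : MvPolynomial (QuiverRep.Coord d₁ d₂) K, ∀ x, MvPolynomial.eval x.coord f = φ x := by
  constructor
  · rintro ⟨f, rfl⟩
    exact ⟨f, fun x => (aeval_coord_apply f x).symm⟩
  · rintro ⟨f, hf⟩
    exact ⟨f, funext fun x => (aeval_coord_apply f x).trans (hf x)⟩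

theorem coord_mem_regularFunctions (c : QuiverRep.Coord d₁ d₂) :
    (fun x : QuiverRep K d₁ d₂ => x.coord c) ∈ regularFunctions K d₁ d₂ :=
  mem_regularFunctions_iff.2 ⟨MvPolynomial.X c, fun x => by simp⟩

theorem linear_mem_regularFunctions {a b : ℕ} (ℓ : Matrix (Fin a) (Fin b) K →ₗ[K] K)
    (N : QuiverRep K d₁ d₂ → Matrix (Fin a) (Fin b) K)
    (hN : ∀ i j, (fun x => N x i j) ∈ regularFunctions K d₁ d₂) :
    (fun x => ℓ (N x)) ∈ regularFunctions K d₁ d₂ := by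
  have h : (fun x => ℓ (N x)) = ∑ i, ∑ j, (fun x => N x i j) *
      algebraMap K (QuiverRep K d₁ d₂ → K) (ℓ (Matrix.single i j 1)) := by
    funext x
    conv_lhs => rw [Matrix.matrix_eq_sum_single (N x)]
    simp only [map_sum, Finset.sum_apply, Pi.mul_apply, Pi.algebraMap_apply,
      Algebra.algebraMap_self, RingHom.id_apply]
    refine Finset.sum_congr rfl fun i _ => Finset.sum_congr rfl fun j _ => ?_
    rw [← smul_eq_mul, ← map_smul, Matrix.smul_single, smul_eq_mul, mul_one]
  rw [h]
  exact sum_mem fun i _ => sum_mem fun j _ => mul_mem (hN i j) (Subalgebra.algebraMap_mem _ _)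

theorem isOpen_ne_zero {φ : QuiverRep K d₁ d₂ → K} (hφ : φ ∈ regularFunctions K d₁ d₂) :
    IsOpen {x | φ x ≠ 0} := by
  obtain ⟨f, hf⟩ := mem_regularFunctions_iff.1 hφ
  exact TopologicalSpace.isOpen_generateFrom_of_mem ⟨f, by simp only [hf]⟩

/-- Products of polynomials give intersections, so the principal open sets form a basis. -/
theorem exists_polynomial_of_isOpen {V : Set (QuiverRep K d₁ d₂)} (hV : IsOpen V)
    {x : QuiverRep K d₁ d₂} (hx : x ∈ V) :
    ∃ f : MvPolynomial (QuiverRep.Coord d₁ d₂) K, MvPolynomial.eval x.coord f ≠ 0 ∧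
      ∀ y : QuiverRep K d₁ d₂, MvPolynomial.eval y.coord f ≠ 0 → y ∈ V := by
  induction hV with
  | basic U hU =>
    obtain ⟨f, rfl⟩ := hU
    exact ⟨f, hx, fun y hy => hy⟩
  | univ => exact ⟨1, by simp, fun y _ => trivial⟩
  | inter U W _ _ ihU ihW =>
    obtain ⟨f, hf, hf'⟩ := ihU hx.1
    obtain ⟨g, hg, hg'⟩ := ihW hx.2
    refine ⟨f * g, by rw [map_mul]; exact mul_ne_zero hf hg, fun y hy => ?_⟩
    rw [map_mul] at hy
    exact ⟨hf' y (left_ne_zero_of_mul hy), hg' y (right_ne_zero_of_mul hy)⟩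
  | sUnion S _ ih =>
    obtain ⟨U, hU, hxU⟩ := hx
    obtain ⟨f, hf, hf'⟩ := ih U hU hxU
    exact ⟨f, hf, fun y hy => ⟨U, hU, hf' y hy⟩⟩

/-- The point with parameter `t` on the line through `(A, B, C)` and `(A, B, C')`. -/
def lineMapC (x : QuiverRep K d₁ d₂) (C' : Matrix (Fin d₂) (Fin d₁) K) (t : K) :
    QuiverRep K d₁ d₂ :=
  ⟨x.A, x.B, x.C + t • (C' - x.C)⟩

theorem exists_polynomial_lineMapC (x : QuiverRep K d₁ d₂) (C' : Matrix (Fin d₂) (Fin d₁) K)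
    (f : MvPolynomial (QuiverRep.Coord d₁ d₂) K) :
    ∃ F : K[X], ∀ t, F.eval t = MvPolynomial.eval (lineMapC x C' t).coord f := by
  let x' : QuiverRep K d₁ d₂ := ⟨x.A, x.B, C'⟩
  let σ : QuiverRep.Coord d₁ d₂ → K[X] := fun c => C (x.coord c) + X * C (x'.coord c - x.coord c)
  refine ⟨MvPolynomial.aeval σ f, fun t => ?_⟩
  have h := MvPolynomial.comp_aeval_apply (R := K) σ (Polynomial.aeval t) f
  rw [Polynomial.coe_aeval_eq_eval] at h
  rw [h, ← MvPolynomial.coe_aeval_eq_eval]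
  change MvPolynomial.aeval _ f = MvPolynomial.aeval _ f
  congr 2
  funext c
  rcases c with c | c | c <;>
    simp [σ, x', QuiverRep.coord, lineMapC]

/-- If a nonempty open part of the line through `(A, B, C)` and `(A, B, C')` lies in `S`, then
`(A, B, C)` lies in the closure of `S`. -/
theorem mem_closure_of_lineMapC [Infinite K] {x : QuiverRep K d₁ d₂}
    {C' : Matrix (Fin d₂) (Fin d₁) K} {S : Set (QuiverRep K d₁ d₂)}
    {φ : QuiverRep K d₁ d₂ → K} (hφ : φ ∈ regularFunctions K d₁ d₂)
    (h1 : φ (lineMapC x C' 1) ≠ 0) (hS : ∀ t, φ (lineMapC x C' t) ≠ 0 → lineMapC x C' t ∈ S) :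
    x ∈ closure S := by
  rw [mem_closure_iff]
  intro V hV hx
  obtain ⟨f, hf, hf'⟩ := exists_polynomial_of_isOpen hV hx
  obtain ⟨g, hg⟩ := mem_regularFunctions_iff.1 hφ
  obtain ⟨F, hF⟩ := exists_polynomial_lineMapC x C' f
  obtain ⟨G, hG⟩ := exists_polynomial_lineMapC x C' g
  have hx0 : lineMapC x C' 0 = x := by simp [lineMapC]
  -- `F` is nonzero at `t = 0` and `G` at `t = 1`, so over an infinite field some `t` is a root of
  -- neither.
  have hF0 : F ≠ 0 := by
    rintro rfl
    have := hF 0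
    rw [hx0, eval_zero] at this
    exact hf this.symm
  have hG0 : G ≠ 0 := by
    rintro rfl
    have := hG 1
    rw [eval_zero, hg] at this
    exact h1 this.symm
  obtain ⟨t, ht⟩ : ∃ t, (F * G).eval t ≠ 0 := by
    by_contra! h
    exact mul_ne_zero hF0 hG0 (Polynomial.funext fun t => by rw [h t, eval_zero])
  rw [eval_mul, hF, hG, hg] at ht
  exact ⟨lineMapC x C' t, hf' _ (left_ne_zero_of_mul ht), hS t (right_ne_zero_of_mul ht)⟩

end Zariski

/-! ### From infinitesimal transitivity to an open orbit -/

section OpenOrbit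

open Polynomial

variable {K : Type*} [Field K] {d₁ d₂ : ℕ}

/-- The linear map whose kernel is the space of homomorphisms from `y` to `x`. -/
def intertwiningDefect (y x : QuiverRep K d₁ d₂) :
    Matrix (Fin d₁) (Fin d₁) K × Matrix (Fin d₂) (Fin d₂) K →ₗ[K]
      Matrix (Fin d₁) (Fin d₁) K × Matrix (Fin d₂) (Fin d₂) K × Matrix (Fin d₂) (Fin d₁) K where
  toFun z := (z.1 * y.A - x.A * z.1, z.2 * y.B - x.B * z.2, z.2 * y.C - x.C * z.1)
  map_add' z w := by
    simp only [Prod.fst_add, Prod.snd_add, Matrix.add_mul, Matrix.mul_add, Prod.mk_add_mk,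
      Prod.mk.injEq]
    exact ⟨by abel, by abel, by abel⟩
  map_smul' c z := by
    simp [smul_sub]

theorem mem_ker_intertwiningDefect {y x : QuiverRep K d₁ d₂}
    {z : Matrix (Fin d₁) (Fin d₁) K × Matrix (Fin d₂) (Fin d₂) K} :
    intertwiningDefect y x z = 0 ↔
      z.1 * y.A = x.A * z.1 ∧ z.2 * y.B = x.B * z.2 ∧ z.2 * y.C = x.C * z.1 := by
  simp only [intertwiningDefect, LinearMap.coe_mk, AddHom.coe_mk, Prod.mk_eq_zero, sub_eq_zero]

theorem intertwiningDefect_mem_regularFunctions (y : QuiverRep K d₁ d₂)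
    (e : Matrix (Fin d₁) (Fin d₁) K × Matrix (Fin d₂) (Fin d₂) K)
    (ℓ : Matrix (Fin d₁) (Fin d₁) K × Matrix (Fin d₂) (Fin d₂) K × Matrix (Fin d₂) (Fin d₁) K
      →ₗ[K] K) :
    (fun x => ℓ (intertwiningDefect y x e)) ∈ regularFunctions K d₁ d₂ := by
  have hmul : ∀ {a b c : ℕ} (N : QuiverRep K d₁ d₂ → Matrix (Fin a) (Fin b) K)
      (M₀ : Matrix (Fin a) (Fin c) K) (M : Matrix (Fin b) (Fin c) K)
      (_ : ∀ i j, (fun x => N x i j) ∈ regularFunctions K d₁ d₂) (i : Fin a) (j : Fin c),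
      (fun x => (M₀ - N x * M) i j) ∈ regularFunctions K d₁ d₂ := by
    intro a b c N M₀ M hN i j
    have h : (fun x => (M₀ - N x * M) i j) = algebraMap K (QuiverRep K d₁ d₂ → K) (M₀ i j) -
        ∑ k, (fun x => N x i k) * algebraMap K (QuiverRep K d₁ d₂ → K) (M k j) := by
      funext x
      simp [Matrix.mul_apply]
    rw [h]
    exact sub_mem (Subalgebra.algebraMap_mem _ _) (sum_mem fun k _ => mul_mem (hN i k)
      (Subalgebra.algebraMap_mem _ _))
  have h : (fun x => ℓ (intertwiningDefect y x e)) =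
      (fun x => (ℓ ∘ₗ LinearMap.inl K _ _) (e.1 * y.A - x.A * e.1)) +
      ((fun x => (ℓ ∘ₗ LinearMap.inr K _ _ ∘ₗ LinearMap.inl K _ _) (e.2 * y.B - x.B * e.2)) +
      (fun x : QuiverRep K d₁ d₂ =>
        (ℓ ∘ₗ LinearMap.inr K _ _ ∘ₗ LinearMap.inr K _ _)
          ((e.2 * y.C - x.C * e.1 : Matrix (Fin d₂) (Fin d₁) K)))) := by
    funext x
    simp only [Pi.add_apply, LinearMap.comp_apply, ← map_add]
    simp [intertwiningDefect]
  rw [h]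
  exact add_mem
    (linear_mem_regularFunctions _ _ (hmul _ _ _ fun i j =>
      coord_mem_regularFunctions (.inl (i, j))))
    (add_mem
      (linear_mem_regularFunctions _ _ (hmul _ _ _ fun i j =>
        coord_mem_regularFunctions (.inr (.inl (i, j)))))
      (linear_mem_regularFunctions _ _ (hmul _ _ _ fun i j =>
        coord_mem_regularFunctions (.inr (.inr (i, j))))))

/-- The infinitesimal action at `y` reaches every direction tangent to the space of
homomorphisms killed by `B ^ 2`. -/
def IsInfinitesimallyTransitive (y : QuiverRep K d₁ d₂) : Prop :=
  ∀ Z : Matrix (Fin d₂) (Fin d₁) K, Z * y.A = y.B * Z → y.B ^ 2 * Z = 0 →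
    ∃ (g : Matrix (Fin d₁) (Fin d₁) K) (h : Matrix (Fin d₂) (Fin d₂) K),
      g * y.A = y.A * g ∧ h * y.B = y.B * h ∧ Z = h * y.C - y.C * g

/-- After conjugating `x` to `(y.A, y.B, C')`, both Hom spaces are kernels of maps from the same
space `E₀` of pairs of endomorphisms to the same `V`. The map for `y` is onto `V`, so its kernel is
smallest. -/
theorem IsInfinitesimallyTransitive.finrank_ker_le {y x : QuiverRep K d₁ d₂}
    (hy : IsInfinitesimallyTransitive y)
    (hyC : y.C * y.A = y.B * y.C) (hyC2 : y.B ^ 2 * y.C = 0)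
    (hxC : x.C * x.A = x.B * x.C) (hxC2 : x.B ^ 2 * x.C = 0)
    (g : GL (Fin d₁) K) (hg : g.val * y.A = x.A * g.val)
    (h : GL (Fin d₂) K) (hh : h.val * y.B = x.B * h.val) :
    Module.finrank K (LinearMap.ker (intertwiningDefect y y)) ≤
      Module.finrank K (LinearMap.ker (intertwiningDefect y x)) := by
  have hh' : (h⁻¹).val * x.B = y.B * (h⁻¹).val := by
    calc (h⁻¹).val * x.B = (h⁻¹).val * (x.B * h.val) * (h⁻¹).val := by
          rw [Matrix.mul_assoc, Matrix.mul_assoc, Units.mul_inv, Matrix.mul_one]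
      _ = y.B * (h⁻¹).val := by rw [← hh, ← Matrix.mul_assoc, Units.inv_mul, Matrix.one_mul]
  let C' : Matrix (Fin d₂) (Fin d₁) K := (h⁻¹).val * x.C * g.val
  have hC' : C' * y.A = y.B * C' := by
    calc C' * y.A = (h⁻¹).val * (x.C * (g.val * y.A)) := by simp only [C', Matrix.mul_assoc]
      _ = (h⁻¹).val * (x.C * x.A * g.val) := by rw [hg, Matrix.mul_assoc x.C]
      _ = (h⁻¹).val * x.B * (x.C * g.val) := by rw [hxC]; simp only [Matrix.mul_assoc]
      _ = y.B * C' := by rw [hh']; simp only [C', Matrix.mul_assoc]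
  have hC'2 : y.B ^ 2 * C' = 0 := by
    calc y.B ^ 2 * C' = y.B * (y.B * (h⁻¹).val) * (x.C * g.val) := by
          simp only [C', pow_two, Matrix.mul_assoc]
      _ = (h⁻¹).val * (x.B ^ 2 * x.C) * g.val := by
          rw [← hh', ← Matrix.mul_assoc y.B, ← hh']; simp only [pow_two, Matrix.mul_assoc]
      _ = 0 := by rw [hxC2, Matrix.mul_zero, Matrix.zero_mul]
  let y' : QuiverRep K d₁ d₂ := ⟨y.A, y.B, C'⟩
  let δ : QuiverRep K d₁ d₂ → Matrix (Fin d₁) (Fin d₁) K × Matrix (Fin d₂) (Fin d₂) K →ₗ[K]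
      Matrix (Fin d₂) (Fin d₁) K := fun w =>
    LinearMap.snd K _ _ ∘ₗ LinearMap.snd K _ _ ∘ₗ intertwiningDefect y w
  have hδ : ∀ w z, δ w z = z.2 * y.C - w.C * z.1 := fun _ _ => rfl
  let E₀ : Submodule K (Matrix (Fin d₁) (Fin d₁) K × Matrix (Fin d₂) (Fin d₂) K) :=
    LinearMap.ker (LinearMap.fst K _ _ ∘ₗ intertwiningDefect y y) ⊓
      LinearMap.ker (LinearMap.fst K _ _ ∘ₗ LinearMap.snd K _ _ ∘ₗ intertwiningDefect y y)
  have hE₀ : ∀ z, z ∈ E₀ ↔ z.1 * y.A = y.A * z.1 ∧ z.2 * y.B = y.B * z.2 := fun z =>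
    and_congr sub_eq_zero sub_eq_zero
  have hrange : LinearMap.range ((δ y').domRestrict E₀) ≤
      LinearMap.range ((δ y).domRestrict E₀) := by
    rintro _ ⟨⟨z, hz⟩, rfl⟩
    obtain ⟨hz1, hz2⟩ := (hE₀ z).1 hz
    have hZ1 : δ y' z * y.A = y.B * δ y' z := by
      rw [hδ, Matrix.sub_mul, Matrix.mul_sub, Matrix.mul_assoc, hyC, ← Matrix.mul_assoc, hz2,
        Matrix.mul_assoc, Matrix.mul_assoc C', hz1, ← Matrix.mul_assoc C', hC']
      simp only [Matrix.mul_assoc, y']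
    have hZ2 : y.B ^ 2 * δ y' z = 0 := by
      have h1 : y.B ^ 2 * (z.2 * y.C) = 0 := by
        calc y.B ^ 2 * (z.2 * y.C) = y.B * (y.B * z.2) * y.C := by
              simp only [pow_two, Matrix.mul_assoc]
          _ = z.2 * (y.B ^ 2 * y.C) := by
              rw [← hz2, ← Matrix.mul_assoc y.B, ← hz2]; simp only [pow_two, Matrix.mul_assoc]
          _ = 0 := by rw [hyC2, Matrix.mul_zero]
      rw [hδ, Matrix.mul_sub, h1, ← Matrix.mul_assoc, hC'2, Matrix.zero_mul, sub_zero]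
    obtain ⟨a, b, ha, hb, hab⟩ := hy _ hZ1 hZ2
    exact ⟨⟨(a, b), (hE₀ _).2 ⟨ha, hb⟩⟩, hab.symm⟩
  have hle : Module.finrank K (LinearMap.ker ((δ y).domRestrict E₀)) ≤
      Module.finrank K (LinearMap.ker ((δ y').domRestrict E₀)) := by
    have h1 := LinearMap.finrank_range_add_finrank_ker ((δ y).domRestrict E₀)
    have h2 := LinearMap.finrank_range_add_finrank_ker ((δ y').domRestrict E₀)
    have h3 := Submodule.finrank_mono hrange
    omega
  let i₁ : LinearMap.ker (intertwiningDefect y y) →ₗ[K] LinearMap.ker ((δ y).domRestrict E₀) :=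
    { toFun := fun z => ⟨⟨z.1, by
          obtain ⟨a, b, -⟩ := mem_ker_intertwiningDefect.1 z.2
          exact (hE₀ _).2 ⟨a, b⟩⟩, by
          obtain ⟨-, -, c⟩ := mem_ker_intertwiningDefect.1 z.2
          exact sub_eq_zero.2 c⟩
      map_add' := fun _ _ => rfl
      map_smul' := fun _ _ => rfl }
  -- Composition with `(g, h)` turns homomorphisms from `y` to `y'` into homomorphisms from `y` to
  -- `x`.
  let i₂ : LinearMap.ker ((δ y').domRestrict E₀) →ₗ[K] LinearMap.ker (intertwiningDefect y x) :=
    { toFun := fun z => ⟨(g.val * z.1.1.1, h.val * z.1.1.2), by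
          obtain ⟨a, b⟩ := (hE₀ _).1 z.1.2
          have c : z.1.1.2 * y.C = C' * z.1.1.1 := sub_eq_zero.1 z.2
          refine mem_ker_intertwiningDefect.2 ⟨?_, ?_, ?_⟩
          · change g.val * z.1.1.1 * y.A = x.A * (g.val * z.1.1.1)
            rw [Matrix.mul_assoc, a, ← Matrix.mul_assoc, hg, Matrix.mul_assoc]
          · change h.val * z.1.1.2 * y.B = x.B * (h.val * z.1.1.2)
            rw [Matrix.mul_assoc, b, ← Matrix.mul_assoc, hh, Matrix.mul_assoc]
          · change h.val * z.1.1.2 * y.C = x.C * (g.val * z.1.1.1)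
            rw [Matrix.mul_assoc, c]
            simp only [C', ← Matrix.mul_assoc, Units.mul_inv, Matrix.one_mul]⟩
      map_add' := fun z w => Subtype.ext <| Prod.ext (Matrix.mul_add _ _ _) (Matrix.mul_add _ _ _)
      map_smul' := fun c z => Subtype.ext <|
        Prod.ext (Matrix.mul_smul _ _ _) (Matrix.mul_smul _ _ _) }
  have hi₁ : Function.Injective i₁ := fun z w hzw =>
    Subtype.ext (congrArg (fun t => t.1.1) hzw)
  have hi₂ : Function.Injective i₂ := by
    intro z w hzw
    have h1 : (g.val * z.1.1.1, h.val * z.1.1.2) = (g.val * w.1.1.1, h.val * w.1.1.2) :=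
      congrArg Subtype.val hzw
    rw [Prod.mk.injEq] at h1
    exact Subtype.ext (Subtype.ext (Prod.ext ((Units.mul_right_inj g).1 h1.1)
      ((Units.mul_right_inj h).1 h1.2)))
  exact (LinearMap.finrank_le_finrank_of_injective hi₁).trans
    (hle.trans (LinearMap.finrank_le_finrank_of_injective hi₂))

/-- The orbit of a point of a stratum with transitive infinitesimal action contains a principal
open neighbourhood of this point in the stratum. -/
theorem IsInfinitesimallyTransitive.exists_regularFunction {m n s r : ℕ} {p : Fin s → ℕ}
    {q : Fin r → ℕ} {y : QuiverRep K d₁ d₂} (hyS : y ∈ stratum K m n d₁ d₂ p q)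
    (hy : IsInfinitesimallyTransitive y) :
    ∃ φ ∈ regularFunctions K d₁ d₂, φ y ≠ 0 ∧ ∀ x ∈ stratum K m n d₁ d₂ p q, φ x ≠ 0 →
      x ∈ MulAction.orbit (GL (Fin d₁) K × GL (Fin d₂) K) y := by
  -- The kernel vector being extended is the identity endomorphism `(1, 1)` of `y`.
  obtain ⟨D, z, hD, hz, hDy, hzy, hker⟩ := exists_kernel_section (intertwiningDefect y)
    (intertwiningDefect_mem_regularFunctions y) y (1, 1)
    (mem_ker_intertwiningDefect.2 (by simp))
  have hdet₁ : (fun x => (z x).1.det) ∈ regularFunctions K d₁ d₂ := by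
    let N : Matrix (Fin d₁) (Fin d₁) (QuiverRep K d₁ d₂ → K) := Matrix.of fun i j x => (z x).1 i j
    have h1 : (fun x => (z x).1.det) = N.det := by
      funext x
      exact ((Pi.evalRingHom (fun _ : QuiverRep K d₁ d₂ => K) x).map_det N).symm
    rw [h1]
    exact det_mem_subalgebra fun i j => hz (Matrix.entryLinearMap K K i j ∘ₗ LinearMap.fst K _ _)
  have hdet₂ : (fun x => (z x).2.det) ∈ regularFunctions K d₁ d₂ := by
    let N : Matrix (Fin d₂) (Fin d₂) (QuiverRep K d₁ d₂ → K) := Matrix.of fun i j x => (z x).2 i j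
    have h1 : (fun x => (z x).2.det) = N.det := by
      funext x
      exact ((Pi.evalRingHom (fun _ : QuiverRep K d₁ d₂ => K) x).map_det N).symm
    rw [h1]
    exact det_mem_subalgebra fun i j => hz (Matrix.entryLinearMap K K i j ∘ₗ LinearMap.snd K _ _)
  refine ⟨D * ((fun x => (z x).1.det) * fun x => (z x).2.det),
    mul_mem hD (mul_mem hdet₁ hdet₂), ?_, fun x hx hφ => ?_⟩
  · simp [hDy, hzy]
  · simp only [Pi.mul_apply] at hφ
    obtain ⟨⟨-, -, hxC, hxC2⟩, hxA, hxB⟩ := hx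
    obtain ⟨g, hg⟩ := hyS.2.1.exists_GL hxA
    obtain ⟨h, hh⟩ := hyS.2.2.exists_GL hxB
    obtain ⟨hzA, hzB, hzC⟩ := mem_ker_intertwiningDefect.1 (hker x (left_ne_zero_of_mul hφ)
      (hy.finrank_ker_le (sub_eq_zero.1 hyS.1.2.2.1) hyS.1.2.2.2
        (sub_eq_zero.1 hxC) hxC2 g hg h hh))
    have hφ' := right_ne_zero_of_mul hφ
    exact mem_orbit_of_intertwines
      (Matrix.GeneralLinearGroup.mkOfDetNeZero (z x).1 (left_ne_zero_of_mul hφ'))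
      (Matrix.GeneralLinearGroup.mkOfDetNeZero (z x).2 (right_ne_zero_of_mul hφ')) hzA hzB hzC

end OpenOrbit

/-! ### The orbit of the staircase matrix is open and dense -/

section StaircaseOrbit

open Polynomial

variable {K : Type*} [Field K] {m n d₁ d₂ k l : ℕ} {p : Fin (k + 1) → ℕ} {q : Fin l → ℕ}

theorem IsEquivalentTo.exists_regularFunction_staircase
    (hp : IsPartitionOf m d₁ p) (hq : IsPartitionOf n d₂ q)
    (hp_three : ∀ j : Fin k, 3 ≤ p j.castSucc) (hq_two : ∀ i, 2 ≤ q i)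
    {y : QuiverRep K d₁ d₂} (hy : IsEquivalentTo y p q (staircase K p q)) :
    ∃ φ ∈ regularFunctions K d₁ d₂, φ y ≠ 0 ∧ ∀ x ∈ stratum K m n d₁ d₂ p q, φ x ≠ 0 →
      x ∈ MulAction.orbit (GL (Fin d₁) K × GL (Fin d₂) K) y :=
  IsInfinitesimallyTransitive.exists_regularFunction
    (hy.mem_stratum (fun j => (hp.2.1 j).2) (fun i => (hq.2.1 i).2) (sq_dvd_staircase hq_two))
    fun _ hZ hZ2 => hy.exists_eq_sub (fun _ hz hz2 =>
      mem_tangentMatrices_staircase hp.1 hq.1 hp_three hq_two hz hz2) hZ hZ2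

/-- With `A` and `B` fixed, the conditions on `C` are linear. -/
theorem lineMapC_mem_stratum {s r : ℕ} {p : Fin s → ℕ} {q : Fin r → ℕ} {x : QuiverRep K d₁ d₂}
    (hx : x ∈ stratum K m n d₁ d₂ p q) {C' : Matrix (Fin d₂) (Fin d₁) K}
    (hx' : (⟨x.A, x.B, C'⟩ : QuiverRep K d₁ d₂) ∈ stratum K m n d₁ d₂ p q) (t : K) :
    lineMapC x C' t ∈ stratum K m n d₁ d₂ p q := by
  obtain ⟨⟨hA, hB, hC, hC2⟩, hpA, hqB⟩ := hx
  obtain ⟨⟨-, -, hC', hC2'⟩, -, -⟩ := hx'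
  have h1 := sub_eq_zero.1 hC
  have h2 := sub_eq_zero.1 hC'
  refine ⟨⟨hA, hB, ?_, ?_⟩, hpA, hqB⟩
  · rw [sub_eq_zero]
    simp only [lineMapC, Matrix.add_mul, Matrix.mul_add, Matrix.smul_mul, Matrix.mul_smul,
      Matrix.sub_mul, Matrix.mul_sub, h1] at h2 ⊢
    rw [h2]
  · simp only [lineMapC, Matrix.mul_add, Matrix.mul_smul, Matrix.mul_sub] at hC2' ⊢
    rw [hC2, hC2']
    simp

theorem stratum_subset_closure_isEquivalentTo [Infinite K]
    (hp : IsPartitionOf m d₁ p) (hq : IsPartitionOf n d₂ q) (hp_last : p (Fin.last k) = 1)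
    (hp_three : ∀ j : Fin k, 3 ≤ p j.castSucc) (hq_two : ∀ i, 2 ≤ q i) :
    stratum K m n d₁ d₂ p q ⊆ closure {y | IsEquivalentTo y p q (staircase K p q)} := by
  intro x hx
  -- `C'` is chosen over the same `A` and `B` as `x`, so that the line joining them stays in the
  -- stratum.
  obtain ⟨C', hC'⟩ := hx.2.1.exists_isEquivalentTo hx.2.2
    (isHomMatrix_staircase (K := K) hp_last hp_three hq_two)
  obtain ⟨φ, hφ, hφ1, hφx⟩ := hC'.exists_regularFunction_staircase hp hq hp_three hq_two
  have hS := hC'.mem_stratum (m := m) (n := n) (fun j => (hp.2.1 j).2) (fun i => (hq.2.1 i).2)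
    (sq_dvd_staircase hq_two)
  refine mem_closure_of_lineMapC (C' := C') hφ (by simpa [lineMapC] using hφ1) fun t ht => ?_
  exact hC'.of_mem_orbit (hφx _ (lineMapC_mem_stratum hx hS t) ht)

end StaircaseOrbit

theorem mainTheorem6 {K : Type*} [Field K] [Infinite K] (m n d₁ d₂ k l : ℕ)
    (p : Fin (k + 1) → ℕ) (q : Fin l → ℕ)
    (hp : IsPartitionOf m d₁ p) (hq : IsPartitionOf n d₂ q)
    (hp_last : p (Fin.last k) = 1) (hp_three : ∀ j : Fin k, 3 ≤ p j.castSucc)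
    (hq_two : ∀ i, 2 ≤ q i) :
    (∃ U : Set (stratum K m n d₁ d₂ p q), IsOpen U ∧ Dense U ∧
      ∀ x ∈ U, IsEquivalentTo x.val p q (staircase K p q)) ∧
    ∃ x₀ ∈ stratum K m n d₁ d₂ p q, IsEquivalentTo x₀ p q (staircase K p q) ∧
      MulAction.orbit (GL (Fin d₁) K × GL (Fin d₂) K) x₀ ⊆ stratum K m n d₁ d₂ p q ∧
      stratum K m n d₁ d₂ p q ⊆
        closure (MulAction.orbit (GL (Fin d₁) K × GL (Fin d₂) K) x₀) := by
  have hstr : ∀ {x : QuiverRep K d₁ d₂}, IsEquivalentTo x p q (staircase K p q) →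
      x ∈ stratum K m n d₁ d₂ p q := fun hx =>
    hx.mem_stratum (fun j => (hp.2.1 j).2) (fun i => (hq.2.1 i).2) (sq_dvd_staircase hq_two)
  have hclosure : stratum K m n d₁ d₂ p q ⊆ closure {y | IsEquivalentTo y p q (staircase K p q)} :=
    stratum_subset_closure_isEquivalentTo hp hq hp_last hp_three hq_two
  constructor
  · refine ⟨{x | IsEquivalentTo x.val p q (staircase K p q)}, ?_, ?_, fun x hx => hx⟩
    · rw [isOpen_iff_forall_mem_open]
      intro y hy
      obtain ⟨φ, hφ, hφy, hφx⟩ :=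
        IsEquivalentTo.exists_regularFunction_staircase hp hq hp_three hq_two hy
      exact ⟨{x | φ x.val ≠ 0}, fun x hx => IsEquivalentTo.of_mem_orbit hy (hφx x.val x.2 hx),
        (isOpen_ne_zero hφ).preimage continuous_subtype_val, hφy⟩
    · intro x
      rw [closure_subtype]
      refine closure_mono ?_ (hclosure x.2)
      exact fun y hy => ⟨⟨y, hstr hy⟩, hy, rfl⟩
  · obtain ⟨A, hA⟩ := exists_hasType (K := K) p hp.2.2
    obtain ⟨B, hB⟩ := exists_hasType (K := K) q hq.2.2
    obtain ⟨C, hC⟩ := hA.exists_isEquivalentTo hB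
      (isHomMatrix_staircase (K := K) hp_last hp_three hq_two)
    exact ⟨⟨A, B, C⟩, hstr hC, hC, fun x hx => hstr (hC.of_mem_orbit hx),
      hclosure.trans (closure_mono fun y hy => IsEquivalentTo.mem_orbit hy hC)⟩
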